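/- Let $\mathrm{Homeo}_+(S^1)$ be the group of orientation-preserving homeomorphisms of the circle $S^1=\partial\mathbb{D}$. A \emph{lamination} $\Lambda$ of $S^1$ is a closed subset of the space of unordered pairs of distinct points of $S^1$ whose elements (the \emph{leaves}) are pairwise unlinked, where $\{a,b\}$ and $\{c,d\}$ are linked if each connected component of $S^1\setminus\{a,b\}$ contains precisely one of $c,d$. Draw each leaf as a chord of the closed disk $\mathbb{D}$; a \emph{gap} of $\Lambda$ is the closure of a connected component of the complement of the leaves in the open disk. The lamination $\Lambda$ is \emph{dense} if its endpoints are dense in $S^1$, \emph{very full} if each gap is a finite-sided ideal polygon (the convex hull of finitely many, at least three, points of $S^1$), and \emph{loose} if no two distinct leaves share an endpoint unless they are edges of the same gap. A group $G\le\mathrm{Homeo}_+(S^1)$ is \emph{pseudo-fibered} if it is finitely generated and discrete (in the compact-open topology), it admits a dense $G$-invariant lamination, it admits two very full loose $G$-invariant laminations $\Lambda_1,\Lambda_2$ whose sets of endpoints are disjoint, and each nontrivial element of $G$ has at most countably many fixed points in $S^1$. \textbf{Theorem A.} Let $G$ be a torsion-free pseudo-fibered group. Then each subgroup of $G$ either contains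 a non-abelian free subgroup or is virtually abelian. -/

import Mathlib

/-! Groups of circle homeomorphisms and invariant laminations. The circle is the unit circle `Circle`
in `ℂ`, bounding the unit disk; leaves are drawn in the disk as straight chords. -/

namespace CircleLam

/-- A homeomorphism of the circle is orientation preserving: it lifts, through the universal cover
`t ↦ exp (i t)`, to a continuous strictly increasing map of the line. -/
def OrientationPreserving (g : Circle ≃ₜ Circle) : Prop :=
  ∃ F : ℝ → ℝ, Continuous F ∧ StrictMono F ∧ ∀ t : ℝ, g (Circle.exp t) = Circle.exp (F t)

/-- The pairs `{a, b}` and `{c, d}` are linked: each connected component of the complement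
of `{a, b}` in the circle contains precisely one of `c`, `d`. -/
def Linked (a b c d : Circle) : Prop :=
  ∀ x ∈ ({a, b} : Set Circle)ᶜ,
    Xor (c ∈ connectedComponentIn ({a, b} : Set Circle)ᶜ x)
      (d ∈ connectedComponentIn ({a, b} : Set Circle)ᶜ x)

/-- A lamination of the circle: a set of unordered pairs of distinct points (the leaves), closed in
the space of all unordered pairs of distinct points (with the quotient topology from the ordered
pairs off the diagonal), whose elements are pairwise unlinked. -/
structure Lamination where
  /-- the leaves -/
  leaves : Set (Sym2 Circle)
  not_isDiag : ∀ l ∈ leaves, ¬ l.IsDiag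
  isClosed : IsClosed {p : {p : Circle × Circle // p.1 ≠ p.2} | s(p.1.1, p.1.2) ∈ leaves}
  unlinked : ∀ a b c d : Circle, s(a, b) ∈ leaves → s(c, d) ∈ leaves → ¬ Linked a b c d

/-- The chord of the disk that joins the two points of an unordered pair. -/
def chord : Sym2 Circle → Set ℂ :=
  Sym2.lift ⟨fun a b => segment ℝ (a : ℂ) (b : ℂ), fun a b => segment_symm ℝ (a : ℂ) (b : ℂ)⟩

namespace Lamination

/-- The set of endpoints of the leaves. -/
def ends (L : Lamination) : Set Circle := {p | ∃ l ∈ L.leaves, p ∈ l}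

/-- A lamination is dense if its set of endpoints is dense in the circle. -/
def IsDense (L : Lamination) : Prop := Dense L.ends

/-- The union of the leaves, drawn in the disk. -/
def support (L : Lamination) : Set ℂ := ⋃ l ∈ L.leaves, chord l

/-- A gap: the closure of a connected component of the complement of the leaves in the open disk. -/
def IsGap (L : Lamination) (P : Set ℂ) : Prop :=
  ∃ z ∈ Metric.ball (0 : ℂ) 1 \ L.support,
    P = closure (connectedComponentIn (Metric.ball (0 : ℂ) 1 \ L.support) z)

/-- A leaf is an edge of the gap `P` if its chord is part of the boundary of `P`. -/
def IsEdge (L : Lamination) (l : Sym2 Circle) (P : Set ℂ) : Prop :=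
  l ∈ L.leaves ∧ chord l ⊆ frontier P

end Lamination

/-- A finite-sided ideal polygon: the convex hull of finitely many (at least three) points
of the circle. -/
def IsIdealPolygon (P : Set ℂ) : Prop :=
  ∃ V : Finset Circle, 3 ≤ V.card ∧ P = convexHull ℝ ((fun v : Circle => (v : ℂ)) '' (V : Set Circle))

namespace Lamination

/-- Very full: every gap is a finite-sided ideal polygon. -/
def IsVeryFull (L : Lamination) : Prop := ∀ P : Set ℂ, L.IsGap P → IsIdealPolygon P

/-- Loose: two distinct leaves share an endpoint only if they are edges of the same gap. -/
def IsLoose (L : Lamination) : Prop :=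
  ∀ l₁ ∈ L.leaves, ∀ l₂ ∈ L.leaves, l₁ ≠ l₂ → (∃ p : Circle, p ∈ l₁ ∧ p ∈ l₂) →
    ∃ P : Set ℂ, L.IsGap P ∧ L.IsEdge l₁ P ∧ L.IsEdge l₂ P

/-- `L` is `G`-invariant: the induced action on unordered pairs preserves the set of leaves. -/
def IsInvariant (L : Lamination) (G : Subgroup (Circle ≃ₜ Circle)) : Prop :=
  ∀ g ∈ G, Sym2.map g '' L.leaves = L.leaves

end Lamination

/-- A laminar group: a discrete (in the compact-open topology) group of orientation-preserving
circle homeomorphisms with a dense invariant lamination. -/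
def IsLaminar (G : Subgroup (Circle ≃ₜ Circle)) : Prop :=
  (∀ g ∈ G, OrientationPreserving g) ∧
  IsDiscrete ((fun g : Circle ≃ₜ Circle => (g : C(Circle, Circle))) ''
    (G : Set (Circle ≃ₜ Circle))) ∧
  ∃ L : Lamination, L.IsDense ∧ L.IsInvariant G

/-- A pseudo-fibered group: a finitely generated laminar group with a pair of very full loose
invariant laminations with distinct endpoints, such that each nontrivial element has at most
countably many fixed points. -/
def IsPseudoFibered (G : Subgroup (Circle ≃ₜ Circle)) : Prop :=
  G.FG ∧ IsLaminar G ∧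
  (∃ L₁ L₂ : Lamination,
    (L₁.IsVeryFull ∧ L₁.IsLoose ∧ L₁.IsInvariant G) ∧
    (L₂.IsVeryFull ∧ L₂.IsLoose ∧ L₂.IsInvariant G) ∧
    Disjoint L₁.ends L₂.ends) ∧
  ∀ g ∈ G, g ≠ 1 → {x : Circle | g x = x}.Countable

end CircleLam

/-- The group `H` contains a non-abelian free subgroup. -/
def ContainsNonabelianFree (H : Type*) [Group H] : Prop :=
  ∃ K : Subgroup H, IsFreeGroup K ∧ ∃ a ∈ K, ∃ b ∈ K, a * b ≠ b * a

/-- The group `H` is virtually abelian: some subgroup of finite index is abelian. -/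
def IsVirtuallyAbelian (H : Type*) [Group H] : Prop :=
  ∃ A : Subgroup H, A.FiniteIndex ∧ ∀ a ∈ A, ∀ b ∈ A, a * b = b * a

/-!
The proof is a Tits alternative by hand: a subgroup `H` without finite orbits on the circle plays
ping-pong, and the stabilizer of a point is abelian, so that a finite orbit makes `H` virtually
abelian.

*Laminations.* All that is used of a very full loose lamination is the list of order properties in
`LineLam`, stated for its lift to `ℝ`: at most two leaves share an endpoint, a point that is not an
endpoint is enclosed by arbitrarily small leaves, and a leaf on which no leaves accumulate from a
given side has a neighbouring edge on that side. They are read off from the disk in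
`Lamination.lineLam`. The two laminations have no common endpoint, so every point is enclosed by
arbitrarily small leaves of one of them.

*No finite orbit* (`containsFree_of_infinite_orbits`). Let `J` be a small arc cut off by a leaf
around a point of a minimal set `K`. The translates of the open arc cover the circle: otherwise
finitely many components of their union meet `K`, and the ends of these components have finite
orbits. If the translates were pairwise nested or disjoint, a maximal one in a finite subcover
would be open and closed. So two translates of `J` cover the circle, that is, some element of `H`
moves the complement of `J` into `J`. Four disjoint translates of `J` then give a free group by
ping-pong.

*Point stabilizers* (`commute_of_fixed`). Let `g ≠ 1` fix a point. The images under powers of `g`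
of a small leaf around a fixed point `x` converge to a fixed leaf, or to `x`. Hence `x` is
attracting or repelling as soon as it is isolated from one side, and its neighbours `w, y` among
the fixed points span a leaf unless they coincide (`Preserves.leaf_of_consec`). The countable
closed set of fixed points has an isolated point; an accumulation point would be the limit of a
chain of such leaves, which is not compatible with the small leaves around it, so all fixed points
are isolated (`Transverse.isolatedFixed`). It follows that, in the stabilizer of a point `p`, all
nontrivial elements have exactly one fixed point in a common interval `(p, q)`, where they cross
the diagonal: either the interval is the circle minus `p`, or `p` and `q` span a leaf. By an
argument of Solodov (`commute_of_expands`) the germs at `q` form an archimedean ordered group,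
which is abelian by Hölder's theorem (`commute_of_archimedean`).
-/

namespace CircleLam

open Set Filter Topology

/-! ### Archimedean bi-ordered groups -/

/-- Hölder's theorem: an archimedean bi-ordered group is commutative. -/
theorem commute_of_archimedean {Γ : Type*} [Group Γ] [LinearOrder Γ] [MulLeftStrictMono Γ]
    [MulRightStrictMono Γ]
    (harch : ∀ f h : Γ, 1 < f → 1 < h → ∃ n : ℕ, f < h ^ n) (a b : Γ) : a * b = b * a := by
  have : MulLeftMono Γ := mulLeftMono_of_mulLeftStrictMono Γ
  have : MulRightMono Γ := mulRightMono_of_mulRightStrictMono Γ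
  have key : ∀ d x : Γ, 1 < d → ∃ n : ℤ, d ^ n ≤ x ∧ x < d ^ (n + 1) := by
    intro d x hd
    have hmono : StrictMono fun n : ℤ => d ^ n := by
      refine strictMono_int_of_lt_succ fun n => ?_
      rw [zpow_add_one]
      exact lt_mul_of_one_lt_right' _ hd
    have up : ∀ y : Γ, ∃ n : ℤ, y < d ^ n := by
      intro y
      rcases lt_or_ge 1 y with h | h
      · obtain ⟨n, hn⟩ := harch y d h hd
        exact ⟨n, by simpa using hn⟩
      · exact ⟨1, by simpa using lt_of_le_of_lt h hd⟩
    obtain ⟨N, hN⟩ := up x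
    obtain ⟨M, hM⟩ := up x⁻¹
    have hM' : d ^ (-M) < x := by
      rw [zpow_neg]
      exact inv_lt_of_inv_lt' hM
    have hb : ∃ b : ℤ, ∀ z : ℤ, d ^ z ≤ x → z ≤ b :=
      ⟨N, fun z hz => (hmono.lt_iff_lt.1 (lt_of_le_of_lt hz hN)).le⟩
    obtain ⟨n, hn, hmax⟩ := Int.exists_greatest_of_bdd hb ⟨-M, hM'.le⟩
    refine ⟨n, hn, ?_⟩
    by_contra! h
    have := hmax _ h
    omega
  have main : ∀ a b d : Γ, 1 < d → a * b < b * a * (d * d) := by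
    intro a b d hd
    obtain ⟨m, hm1, hm2⟩ := key d a hd
    obtain ⟨n, hn1, hn2⟩ := key d b hd
    calc a * b < d ^ (m + 1) * d ^ (n + 1) := mul_lt_mul_of_lt_of_lt hm2 hn2
      _ = d ^ n * d ^ m * (d * d) := by
          rw [← zpow_add, ← zpow_add]
          have : d * d = d ^ (2 : ℤ) := by rw [zpow_two]
          rw [this, ← zpow_add]; congr 1; ring
      _ ≤ b * a * (d * d) := by gcongr
  have noncomm : ∀ a b : Γ, ¬ b * a < a * b := by
    intro a b hab
    by_cases hmin : ∃ d : Γ, 1 < d ∧ ∀ e, 1 < e → d ≤ e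
    · obtain ⟨d, hd, hmin⟩ := hmin
      have pow : ∀ x : Γ, ∃ n : ℤ, x = d ^ n := by
        intro x
        obtain ⟨n, hn1, hn2⟩ := key d x hd
        refine ⟨n, ?_⟩
        by_contra hne
        have h1 : 1 < (d ^ n)⁻¹ * x := by
          rw [lt_inv_mul_iff_mul_lt, mul_one]
          exact lt_of_le_of_ne hn1 (Ne.symm hne)
        have h2 := hmin _ h1
        rw [le_inv_mul_iff_mul_le, ← zpow_add_one] at h2
        exact absurd hn2 (not_lt.2 h2)
      obtain ⟨m, rfl⟩ := pow a
      obtain ⟨n, rfl⟩ := pow b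
      rw [← zpow_add, ← zpow_add, add_comm] at hab
      exact lt_irrefl _ hab
    · push Not at hmin
      set c := (b * a)⁻¹ * (a * b) with hc
      have hc1 : 1 < c := by rw [hc, lt_inv_mul_iff_mul_lt, mul_one]; exact hab
      obtain ⟨e, he, hec⟩ := hmin c hc1
      have hsq : ∃ d : Γ, 1 < d ∧ d * d ≤ c := by
        by_cases h : e * e ≤ c
        · exact ⟨e, he, h⟩
        · push Not at h
          refine ⟨c * e⁻¹, by rw [lt_mul_inv_iff_mul_lt, one_mul]; exact hec, ?_⟩
          have : e⁻¹ * c < e := by rw [inv_mul_lt_iff_lt_mul]; exact h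
          calc c * e⁻¹ * (c * e⁻¹) = c * (e⁻¹ * c) * e⁻¹ := by group
            _ ≤ c * e * e⁻¹ := by gcongr
            _ = c := by group
      obtain ⟨d, hd, hdc⟩ := hsq
      have h := main a b d hd
      have : a * b = b * a * c := by rw [hc]; group
      rw [this] at h
      exact absurd (lt_of_mul_lt_mul_left' h) (not_lt.2 hdc)
  rcases lt_trichotomy (a * b) (b * a) with h | h | h
  · exact absurd h (noncomm b a)
  · exact h
  · exact absurd h (noncomm a b)

/-! ### Groups of homeomorphisms of an interval with a single crossing point -/

/-- `F` fixes `y` and moves every other point of `(p, q)` away from `y`. -/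
structure Expands (F : ℝ ≃o ℝ) (p y q : ℝ) : Prop where
  left : p < y
  right : y < q
  fixed : F y = y
  lt_self : ∀ t, p < t → t < y → F t < t
  self_lt : ∀ t, y < t → t < q → t < F t

theorem eventually_left_Ioo {p q : ℝ} (h : p < q) : ∀ᶠ t in 𝓝[<] q, p < t ∧ t < q :=
  Ioo_mem_nhdsLT h

/-- Forward orbits of a point below a bound converge to a fixed point. -/
theorem tendsto_iterate_of_lt (F : ℝ ≃o ℝ) {b M : ℝ} (hb : b < F b) (hM : ∀ n : ℕ, F^[n] b ≤ M) :
    ∃ z, Tendsto (fun n => F^[n] b) atTop (𝓝 z) ∧ F z = z ∧ b < z ∧ z ≤ M ∧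
      (∀ n, F^[n] b ≤ z) ∧ ∀ s, b ≤ s → F s = s → z ≤ s := by
  have hmono : Monotone fun n => F^[n] b :=
    monotone_nat_of_le_succ fun n => by
      rw [Function.iterate_succ_apply]
      exact (F.monotone.iterate n) hb.le
  have hbdd : BddAbove (range fun n => F^[n] b) := ⟨M, by rintro _ ⟨n, rfl⟩; exact hM n⟩
  have ht := tendsto_atTop_ciSup hmono hbdd
  set z := ⨆ n, F^[n] b
  have hz : F z = z := isFixedPt_of_tendsto_iterate ht F.continuous.continuousAt
  have hle : ∀ n, F^[n] b ≤ z := fun n => le_ciSup hbdd n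
  refine ⟨z, ht, hz, lt_of_lt_of_le hb (hle 1), ciSup_le hM, hle, fun s hs hF => ?_⟩
  refine ciSup_le fun n => ?_
  have := (F.monotone.iterate n) hs
  rwa [Function.iterate_fixed hF] at this

/-- Forward orbits of a point above a bound converge to a fixed point. -/
theorem tendsto_iterate_of_gt (F : ℝ ≃o ℝ) {b M : ℝ} (hb : F b < b) (hM : ∀ n : ℕ, M ≤ F^[n] b) :
    ∃ z, Tendsto (fun n => F^[n] b) atTop (𝓝 z) ∧ F z = z ∧ z < b ∧ M ≤ z ∧
      (∀ n, z ≤ F^[n] b) ∧ ∀ s, s ≤ b → F s = s → s ≤ z := by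
  have hmono : Antitone fun n => F^[n] b :=
    antitone_nat_of_succ_le fun n => by
      rw [Function.iterate_succ_apply]
      exact (F.monotone.iterate n) hb.le
  have hbdd : BddBelow (range fun n => F^[n] b) := ⟨M, by rintro _ ⟨n, rfl⟩; exact hM n⟩
  have ht := tendsto_atTop_ciInf hmono hbdd
  set z := ⨅ n, F^[n] b
  have hz : F z = z := isFixedPt_of_tendsto_iterate ht F.continuous.continuousAt
  have hle : ∀ n, z ≤ F^[n] b := fun n => ciInf_le hbdd n
  refine ⟨z, ht, hz, lt_of_le_of_lt (hle 1) hb, le_ciInf hM, hle, fun s hs hF => ?_⟩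
  refine le_ciInf fun n => ?_
  have := (F.monotone.iterate n) hs
  rwa [Function.iterate_fixed hF] at this

/-- Solodov: if every nontrivial element of a group of homeomorphisms of an interval has exactly
one fixed point, where it crosses the diagonal, then the group is abelian. The germs at the right
end order the group, and the order is archimedean: if `f` exceeded all powers of `h` near `q`, then,
since `f` and `h ^ n` cross only once, orbits of `h` would be trapped on one side of its fixed
point. -/
theorem commute_of_expands (Γ : Subgroup (ℝ ≃o ℝ)) {p q : ℝ}
    (hp : ∀ F ∈ Γ, F p = p) (hq : ∀ F ∈ Γ, F q = q)
    (hΓ : ∀ F ∈ Γ, F ≠ 1 → ∃ y, Expands F p y q ∨ Expands F⁻¹ p y q)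
    (f : ℝ ≃o ℝ) (hf : f ∈ Γ) (h : ℝ ≃o ℝ) (hh : h ∈ Γ) : f * h = h * f := by
  by_cases hpq : p < q
  swap
  · have one : ∀ F ∈ Γ, F = 1 := by
      intro F hF
      by_contra hne
      obtain ⟨y, hy | hy⟩ := hΓ F hF hne
      · exact hpq (hy.left.trans hy.right)
      · exact hpq (hy.left.trans hy.right)
    rw [one f hf, one h hh]
  have germ : ∀ F ∈ Γ, F ≠ 1 → (∃ y, Expands F p y q) ∧ (∀ᶠ t in 𝓝[<] q, t < F t) ∨
      (∃ y, Expands F⁻¹ p y q) ∧ (∀ᶠ t in 𝓝[<] q, F t < t) := by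
    intro F hF hne
    obtain ⟨y, hy | hy⟩ := hΓ F hF hne
    · exact Or.inl ⟨⟨y, hy⟩, (eventually_left_Ioo hy.right).mono fun t ht => hy.self_lt t ht.1 ht.2⟩
    · refine Or.inr ⟨⟨y, hy⟩, (eventually_left_Ioo hy.right).mono fun t ht => ?_⟩
      have := F.strictMono (hy.self_lt t ht.1 ht.2)
      rwa [← RelIso.mul_apply, mul_inv_cancel] at this
  let lt : Γ → Γ → Prop := fun a b => ∀ᶠ t in 𝓝[<] q, a.1 t < b.1 t
  have lt_irrefl' : ∀ a, ¬ lt a a := fun a ha => by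
    obtain ⟨t, ht⟩ := ha.exists
    exact lt_irrefl _ ht
  have lt_trans' : ∀ a b c, lt a b → lt b c → lt a c := fun a b c hab hbc => by
    filter_upwards [hab, hbc] with t h1 h2 using h1.trans h2
  have lt_tri : ∀ a b, a ≠ b → lt a b ∨ lt b a := by
    intro a b hab
    have hne : a.1⁻¹ * b.1 ≠ 1 := fun h0 => hab (Subtype.ext (inv_mul_eq_one.1 h0))
    rcases germ _ (Γ.mul_mem (Γ.inv_mem a.2) b.2) hne with ⟨-, h1⟩ | ⟨-, h1⟩
    · left
      filter_upwards [h1] with t ht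
      have := a.1.strictMono ht
      rwa [← RelIso.mul_apply, mul_inv_cancel_left] at this
    · right
      filter_upwards [h1] with t ht
      have := a.1.strictMono ht
      rwa [← RelIso.mul_apply, mul_inv_cancel_left] at this
  let _ : LinearOrder Γ :=
    { le := fun a b => a = b ∨ lt a b
      lt := lt
      le_refl := fun a => Or.inl rfl
      le_trans := by
        rintro a b c (rfl | h1) (rfl | h2)
        · exact Or.inl rfl
        · exact Or.inr h2
        · exact Or.inr h1
        · exact Or.inr (lt_trans' _ _ _ h1 h2)
      le_antisymm := by
        rintro a b (rfl | h1) (h2 | h2)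
        · rfl
        · rfl
        · exact h2.symm
        · exact absurd (lt_trans' _ _ _ h1 h2) (lt_irrefl' _)
      lt_iff_le_not_ge := by
        intro a b
        constructor
        · intro h1
          refine ⟨Or.inr h1, ?_⟩
          rintro (rfl | h2)
          · exact lt_irrefl' _ h1
          · exact lt_irrefl' _ (lt_trans' _ _ _ h1 h2)
        · rintro ⟨rfl | h1, h2⟩
          · exact absurd (Or.inl rfl) h2
          · exact h1
      le_total := by
        intro a b
        by_cases hab : a = b
        · exact Or.inl (Or.inl hab)
        · exact (lt_tri a b hab).imp Or.inr Or.inr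
      toDecidableLE := Classical.decRel _ }
  have lt_def : ∀ a b : Γ, a < b ↔ ∀ᶠ t in 𝓝[<] q, a.1 t < b.1 t := fun a b => Iff.rfl
  have : MulLeftStrictMono Γ := ⟨fun c a b hab => by
    rw [lt_def] at hab ⊢
    filter_upwards [hab] with t ht using c.1.strictMono ht⟩
  have : MulRightStrictMono Γ := ⟨fun c a b hab => by
    change a * c < b * c
    rw [lt_def] at hab ⊢
    have hc : Tendsto c.1 (𝓝[<] q) (𝓝[<] q) := by
      refine tendsto_nhdsWithin_iff.2 ⟨?_, ?_⟩
      · have := (c.1.continuous.tendsto q).mono_left (nhdsWithin_le_nhds (s := Iio q))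
        rwa [hq _ c.2] at this
      · filter_upwards [self_mem_nhdsWithin] with t ht
        have := c.1.strictMono ht
        rwa [hq _ c.2] at this
    exact hc.eventually hab⟩
  have pos : ∀ a : Γ, 1 < a → ∃ y, Expands a.1 p y q := by
    intro a ha
    have hne : a.1 ≠ 1 := fun h0 => (ne_of_gt ha) (Subtype.ext h0)
    rcases germ a.1 a.2 hne with ⟨h1, -⟩ | ⟨-, h1⟩
    · exact h1
    · rw [lt_def] at ha
      obtain ⟨t, h2, h3⟩ := (ha.and h1).exists
      exact absurd (h2.trans h3) (lt_irrefl _)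
  have harch : ∀ f h : Γ, 1 < f → 1 < h → ∃ n : ℕ, f < h ^ n := by
    intro f h hf hh
    obtain ⟨x, hx⟩ := pos f hf
    obtain ⟨y, hy⟩ := pos h hh
    by_contra! hcon
    have : MulLeftMono Γ := mulLeftMono_of_mulLeftStrictMono Γ
    have hcon' : ∀ n : ℕ, h ^ n < f := fun n =>
      lt_of_lt_of_le (by rw [pow_succ]; exact lt_mul_of_one_lt_right' _ hh) (hcon (n + 1))
    have hpow : ∀ (n : ℕ) t, (h ^ n).1 t = (h.1)^[n] t := by
      intro n t
      induction n generalizing t with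
      | zero => rfl
      | succ n ih => rw [pow_succ, Function.iterate_succ_apply, ← ih]; rfl
    -- `f` and `h ^ n` agree at a single point `z`
    have cross : ∀ n : ℕ, ∃ z, (∀ t, p < t → t < z → f.1 t < h.1^[n] t) ∧
        ∀ t, z < t → t < q → h.1^[n] t < f.1 t := by
      intro n
      have h1 : 1 < (h ^ n)⁻¹ * f := by
        rw [lt_inv_mul_iff_mul_lt, mul_one]; exact hcon' n
      obtain ⟨z, hz⟩ := pos _ h1
      have e : ∀ t, (h ^ n).1 (((h ^ n)⁻¹ * f).1 t) = f.1 t := fun t => by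
        rw [← RelIso.mul_apply, ← Subgroup.coe_mul, mul_inv_cancel_left]
      refine ⟨z, fun t h2 h3 => ?_, fun t h2 h3 => ?_⟩
      · have := (h ^ n).1.strictMono (hz.lt_self t h2 h3)
        rwa [e, hpow] at this
      · have := (h ^ n).1.strictMono (hz.self_lt t h2 h3)
        rwa [e, hpow] at this
    rcases lt_or_ge x y with hxy | hxy
    · obtain ⟨t, hyt, htq⟩ := exists_between hy.right
      have hb : ∀ n : ℕ, h.1^[n] t ≤ f.1 t := by
        intro n
        obtain ⟨z, hz1, hz2⟩ := cross n
        have hzy : z ≤ y := by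
          by_contra! hyz
          have h1 := hz1 y hy.left hyz
          rw [Function.iterate_fixed hy.fixed] at h1
          exact lt_asymm h1 (hx.self_lt y hxy hy.right)
        exact (hz2 t (hzy.trans_lt hyt) htq).le
      obtain ⟨z, -, hz, htz, hzM, -⟩ := tendsto_iterate_of_lt h.1 (hy.self_lt t hyt htq) hb
      have : f.1 t < q := by
        have := f.1.strictMono htq
        rwa [hq _ f.2] at this
      have := hy.self_lt z (hyt.trans htz) (hzM.trans_lt this)
      exact absurd hz this.ne'
    · obtain ⟨t, hpt, hty⟩ := exists_between hy.left
      have hb : ∀ n : ℕ, f.1 t ≤ h.1^[n] t := by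
        intro n
        obtain ⟨z, hz1, hz2⟩ := cross n
        have hyz : y ≤ z := by
          by_contra! hzy
          have h1 := hz2 y hzy hy.right
          rw [Function.iterate_fixed hy.fixed] at h1
          rcases hxy.lt_or_eq with hyx | hyx
          · exact absurd (hx.lt_self y hy.left hyx) (not_lt.2 h1.le)
          · rw [hyx, hx.fixed] at h1
            exact lt_irrefl _ h1
        exact (hz1 t hpt (hty.trans_le hyz)).le
      obtain ⟨z, -, hz, hzt, hzM, -⟩ := tendsto_iterate_of_gt h.1 (hy.lt_self t hpt hty) hb
      have : p < f.1 t := by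
        have := f.1.strictMono hpt
        rwa [hp _ f.2] at this
      have := hy.lt_self z (this.trans_le hzM) (hzt.trans hty)
      exact absurd hz this.ne
  exact congrArg Subtype.val (commute_of_archimedean harch ⟨f, hf⟩ ⟨h, hh⟩)

/-! ### Laminations and their automorphisms on the universal cover -/

/-- The order-theoretic properties of the lift of a very full loose lamination to the universal
cover `ℝ → ℝ / Tℤ`. `A a b` says that `a < b < a + T` and that the points below `a` and `b` span a
leaf. -/
structure LineLam (T : ℝ) (A : ℝ → ℝ → Prop) : Prop where
  pos : 0 < T
  lt : ∀ {a b}, A a b → a < b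
  lt_add : ∀ {a b}, A a b → b < a + T
  swap : ∀ {a b}, A b (a + T) ↔ A a b
  unlinked : ∀ {a b c d}, A a b → A c d → a < c → c < b → b < d → d < a + T → False
  /-- the leaves form a closed set of pairs -/
  closed : ∀ {u v : ℕ → ℝ} {a b}, (∀ n, A (u n) (v n)) → Tendsto u atTop (𝓝 a) →
    Tendsto v atTop (𝓝 b) → a < b → b < a + T → A a b
  /-- at most two leaves share an endpoint -/
  three : ∀ {x a b c}, A x a → A x b → A x c → a < b → b < c → False
  /-- a point that is not an endpoint is a nested intersection of arcs cut off by leaves -/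
  rainbow : ∀ {t}, (∀ b, ¬ A t b) → ∀ ε > 0, ∃ a b, A a b ∧ t - ε < a ∧ a < t ∧ t < b ∧ b < t + ε
  /-- on each side of a leaf, either a further leaf starts at one of its endpoints, or leaves
  accumulate on it -/
  side : ∀ {p q}, A p q → (∃ v, p < v ∧ v < q ∧ (A p v ∨ A v q)) ∨
    ∀ ε > 0, ∃ c d, A c d ∧ p < c ∧ c < p + ε ∧ q - ε < d ∧ d < q

/-- `F` commutes with the deck translation by `T` and preserves the leaves of `A`. -/
structure Preserves (T : ℝ) (A : ℝ → ℝ → Prop) (F : ℝ ≃o ℝ) : Prop where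
  shift : ∀ t, F (t + T) = F t + T
  map : ∀ {a b}, A (F a) (F b) ↔ A a b

/-- `x < y` are consecutive fixed points of `F`. -/
structure Consec (F : ℝ ≃o ℝ) (x y : ℝ) : Prop where
  left : F x = x
  right : F y = y
  lt : x < y
  between : ∀ s, x < s → s < y → F s ≠ s

/-- The fixed points of `F` do not accumulate at `x`. -/
def IsolatedFixed (F : ℝ ≃o ℝ) (x : ℝ) : Prop :=
  ∃ ε > 0, ∀ s, x - ε < s → s < x + ε → F s = s → s = x

theorem inv_fixed {F : ℝ ≃o ℝ} {x : ℝ} : F⁻¹ x = x ↔ F x = x := by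
  constructor
  · intro h
    conv_lhs => rw [← h]
    rw [← RelIso.mul_apply, mul_inv_cancel, RelIso.one_apply]
  · intro h
    conv_lhs => rw [← h]
    rw [← RelIso.mul_apply, inv_mul_cancel, RelIso.one_apply]

theorem inv_lt_self {F : ℝ ≃o ℝ} {x : ℝ} : F⁻¹ x < x ↔ x < F x := by
  rw [← F.lt_iff_lt, ← RelIso.mul_apply, mul_inv_cancel, RelIso.one_apply]

theorem self_lt_inv {F : ℝ ≃o ℝ} {x : ℝ} : x < F⁻¹ x ↔ F x < x := by
  rw [← F.lt_iff_lt, ← RelIso.mul_apply, mul_inv_cancel, RelIso.one_apply]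

/-- A homeomorphism moves all points between consecutive fixed points in the same direction. -/
theorem sign_of_no_fixed {F : ℝ ≃o ℝ} {x y : ℝ} (h : ∀ s, x < s → s < y → F s ≠ s) :
    (∀ t, x < t → t < y → t < F t) ∨ ∀ t, x < t → t < y → F t < t := by
  by_contra! hcon
  obtain ⟨⟨s, hs1, hs2, hs3⟩, t, ht1, ht2, ht3⟩ := hcon
  have hc : ContinuousOn (fun r => F r - r) (Ioo x y) :=
    (F.continuous.sub continuous_id).continuousOn
  obtain ⟨r, hr, hr0⟩ := (isPreconnected_Ioo (a := x) (b := y)).intermediate_value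
    (a := s) (b := t) ⟨hs1, hs2⟩ ⟨ht1, ht2⟩ hc (show (0 : ℝ) ∈ Icc _ _ by
      simp only [mem_Icc]; constructor <;> linarith)
  exact h r hr.1 hr.2 (by simpa [sub_eq_zero] using hr0)

theorem Consec.inv {F : ℝ ≃o ℝ} {x y : ℝ} (h : Consec F x y) : Consec F⁻¹ x y :=
  ⟨inv_fixed.2 h.left, inv_fixed.2 h.right, h.lt, fun s h1 h2 h3 =>
    h.between s h1 h2 (inv_fixed.1 h3)⟩

theorem Consec.unique_right {F : ℝ ≃o ℝ} {x y z : ℝ} (h : Consec F x y) (hz : F z = z)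
    (hxz : x < z) : y ≤ z := by
  by_contra! hlt
  exact h.between z hxz hlt hz

theorem Consec.unique_left {F : ℝ ≃o ℝ} {x y z : ℝ} (h : Consec F x y) (hz : F z = z)
    (hzy : z < y) : z ≤ x := by
  by_contra! hlt
  exact h.between z hlt hzy hz

theorem isClosed_fixed (F : ℝ ≃o ℝ) : IsClosed {s | F s = s} :=
  isClosed_eq F.continuous continuous_id

theorem exists_consec_right {F : ℝ ≃o ℝ} {x z ε : ℝ} (hx : F x = x) (hε : 0 < ε)
    (h : ∀ s, x < s → s < x + ε → F s ≠ s) (hz : F z = z) (hxz : x < z) : ∃ y, Consec F x y := by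
  have hzε : x + ε ≤ z := by
    by_contra! hlt
    exact h z hxz hlt hz
  obtain ⟨y, hy⟩ := (isCompact_Icc.inter_right (isClosed_fixed F)).exists_isLeast
    (⟨z, ⟨hzε, le_rfl⟩, hz⟩ : (Icc (x + ε) z ∩ {s | F s = s}).Nonempty)
  refine ⟨y, hx, hy.1.2, by linarith [hy.1.1.1], fun s h1 h2 h3 => ?_⟩
  have hs : x + ε ≤ s := by
    by_contra! hlt
    exact h s h1 hlt h3
  exact absurd (hy.2 ⟨⟨hs, h2.le.trans hy.1.1.2⟩, h3⟩) (not_le.2 h2)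

theorem exists_consec_left {F : ℝ ≃o ℝ} {x z ε : ℝ} (hx : F x = x) (hε : 0 < ε)
    (h : ∀ s, x - ε < s → s < x → F s ≠ s) (hz : F z = z) (hxz : z < x) : ∃ y, Consec F y x := by
  have hzε : z ≤ x - ε := by
    by_contra! hlt
    exact h z hlt hxz hz
  obtain ⟨y, hy⟩ := (isCompact_Icc.inter_right (isClosed_fixed F)).exists_isGreatest
    (⟨z, ⟨le_rfl, hzε⟩, hz⟩ : (Icc z (x - ε) ∩ {s | F s = s}).Nonempty)
  refine ⟨y, hy.1.2, hx, by linarith [hy.1.1.2], fun s h1 h2 h3 => ?_⟩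
  have hs : s ≤ x - ε := by
    by_contra! hlt
    exact h s hlt h2 h3
  exact absurd (hy.2 ⟨⟨hy.1.1.1.trans h1.le, hs⟩, h3⟩) (not_le.2 h1)

/-- A nonempty closed countable set has an isolated point. -/
theorem exists_isolatedFixed {F : ℝ ≃o ℝ} (hc : {s | F s = s}.Countable) {x : ℝ} (hx : F x = x) :
    ∃ x, F x = x ∧ IsolatedFixed F x := by
  by_contra! hcon
  have hperf : Perfect {s | F s = s} := by
    refine ⟨isClosed_fixed F, preperfect_iff_nhds.2 fun y hy U hU => ?_⟩
    obtain ⟨ε, hε, hsub⟩ := Metric.mem_nhds_iff.1 hU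
    by_contra! hne
    refine hcon y hy ⟨ε, hε, fun s h1 h2 h3 => hne s ⟨hsub ?_, h3⟩⟩
    rw [Metric.mem_ball, Real.dist_eq, abs_lt]
    constructor <;> linarith
  obtain ⟨f, hf, -, hinj⟩ := hperf.exists_nat_bool_injection ⟨x, hx⟩
  have hcount : Countable (ℕ → Bool) :=
    have := hc.to_subtype
    (Function.Injective.codRestrict (fun x => hf ⟨x, rfl⟩) hinj).countable
  have hle := Cardinal.mk_le_aleph0_iff.2 hcount
  rw [Cardinal.mk_arrow] at hle
  simp only [Cardinal.mk_fintype, Fintype.card_bool, Cardinal.mk_nat, Cardinal.lift_id] at hle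
  exact absurd hle (not_le.2 (by exact_mod_cast Cardinal.cantor Cardinal.aleph0))

namespace Preserves

variable {T : ℝ} {A : ℝ → ℝ → Prop} {F : ℝ ≃o ℝ}

theorem inv (hF : Preserves T A F) : Preserves T A F⁻¹ := by
  refine ⟨fun t => F.injective ?_, fun {a b} => ?_⟩
  · rw [hF.shift, ← RelIso.mul_apply, ← RelIso.mul_apply, mul_inv_cancel]; rfl
  · rw [← hF.map (a := F⁻¹ a), ← RelIso.mul_apply, ← RelIso.mul_apply, mul_inv_cancel]; rfl

theorem shift_sub (hF : Preserves T A F) (t : ℝ) : F (t - T) = F t - T := by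
  have := hF.shift (t - T)
  rw [sub_add_cancel] at this
  linarith

theorem fixed_add (hF : Preserves T A F) {t : ℝ} : F (t + T) = t + T ↔ F t = t := by
  rw [hF.shift, add_left_inj]

theorem fixed_sub (hF : Preserves T A F) {t : ℝ} : F (t - T) = t - T ↔ F t = t := by
  rw [hF.shift_sub, sub_left_inj]

theorem fixed_zsmul (hF : Preserves T A F) {t : ℝ} (n : ℤ) :
    F (t + n • T) = t + n • T ↔ F t = t := by
  induction n using Int.induction_on with
  | zero => simp
  | succ n ih => rw [← ih, add_smul, one_smul, ← add_assoc, hF.fixed_add]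
  | pred n ih => rw [← ih, sub_smul, one_smul, ← add_sub_assoc, hF.fixed_sub]

theorem consec_add (hF : Preserves T A F) {x y : ℝ} (h : Consec F x y) : Consec F (x + T) (y + T) :=
  ⟨hF.fixed_add.2 h.left, hF.fixed_add.2 h.right, by linarith [h.lt], fun s h1 h2 h3 =>
    h.between (s - T) (by linarith) (by linarith) (hF.fixed_sub.2 h3)⟩

theorem map_iterate (hF : Preserves T A F) {a b : ℝ} (h : A a b) (n : ℕ) :
    A (F^[n] a) (F^[n] b) := by
  induction n with
  | zero => exact h
  | succ n ih =>
    rw [Function.iterate_succ_apply', Function.iterate_succ_apply']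
    exact hF.map.2 ih

variable (hA : LineLam T A) (hF : Preserves T A F)
include hA hF

/-- Since at most two leaves start at a fixed endpoint, they are fixed too. -/
theorem fixed_right {a b : ℝ} (h : A a b) (ha : F a = a) : F b = b := by
  have h1 : A a (F b) := by have := hF.map.2 h; rwa [ha] at this
  have h2 : A a (F (F b)) := by have := hF.map.2 h1; rwa [ha] at this
  rcases lt_trichotomy (F b) b with hb | hb | hb
  · exact (hA.three h2 h1 h (F.strictMono hb) hb).elim
  · exact hb
  · exact (hA.three h h1 h2 hb (F.strictMono hb)).elim

theorem fixed_left {a b : ℝ} (h : A a b) (hb : F b = b) : F a = a :=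
  hF.fixed_add.1 (hF.fixed_right hA (hA.swap.2 h) hb)

/-- A leaf that separates two fixed points and is pushed out at one end is pushed out at the
other. -/
theorem lt_of_leaf {a b x z : ℝ} (h : A a b) (hax : a < x) (hxb : x < b) (hx : F x = x)
    (hz : F z = z) (hbz : b < z) (hza : z < a + T) (hb : b < F b) : F a < a := by
  rcases lt_trichotomy (F a) a with h1 | h1 | h1
  · exact h1
  · exact absurd (hF.fixed_right hA h h1) hb.ne'
  · have h2 := F.strictMono hax
    have h3 := F.strictMono hbz
    rw [hx] at h2
    rw [hz] at h3
    exact (hA.unlinked h (hF.map.2 h) h1 (h2.trans hxb) hb (h3.trans hza)).elim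

theorem lt_of_leaf' {a b x z : ℝ} (h : A a b) (hax : a < x) (hxb : x < b) (hx : F x = x)
    (hz : F z = z) (hbz : b < z) (hza : z < a + T) (hb : F b < b) : a < F a :=
  inv_lt_self.1 (hF.inv.lt_of_leaf hA h hax hxb (inv_fixed.2 hx) (inv_fixed.2 hz) hbz hza
    (self_lt_inv.2 hb))

/-- Small leaves around a fixed point are unlinked with their images, so they cannot be pushed in
one direction. -/
theorem exists_not_lt {x : ℝ} (hx : F x = x) (hend : ∀ b, ¬ A x b) :
    ¬ ∀ t, x < t → t < x + T → t < F t := by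
  intro hcon
  have hT := hA.pos
  set m := F⁻¹ (x + T / 2) with hm
  have hFm : F m = x + T / 2 := by
    rw [hm, ← RelIso.mul_apply, mul_inv_cancel, RelIso.one_apply]
  have hxm : x < m := by
    rw [← F.lt_iff_lt, hFm, hx]; linarith
  obtain ⟨a, b, hab, h1, h2, h3, h4⟩ :=
    hA.rainbow hend (min (T / 2) (m - x)) (lt_min (by linarith) (by linarith))
  have h5 := min_le_left (T / 2) (m - x)
  have h6 := min_le_right (T / 2) (m - x)
  have h7 := hcon b h3 (by linarith)
  have h8 := hcon (a + T) (by linarith) (by linarith)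
  rw [hF.shift] at h8
  have h9 := F.strictMono (show b < m by linarith)
  have h10 := F.strictMono h2
  exact hA.unlinked hab (hF.map.2 hab) (by linarith) (by linarith) h7 (by linarith)

theorem exists_fixed {x : ℝ} (hx : F x = x) (hend : ∀ b, ¬ A x b) :
    ∃ z, F z = z ∧ x < z ∧ z < x + T := by
  by_contra! hcon
  rcases sign_of_no_fixed (F := F) (x := x) (y := x + T)
    (fun s h1 h2 h3 => absurd h2 (not_lt.2 (hcon s h3 h1))) with h | h
  · exact hF.exists_not_lt hA hx hend h
  · exact hF.inv.exists_not_lt hA (inv_fixed.2 hx) hend fun t h1 h2 => self_lt_inv.2 (h t h1 h2)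

/-- Around a fixed point that is not an endpoint there are arbitrarily small leaves that separate
it from another fixed point. -/
theorem exists_small_leaf {x ε : ℝ} (hx : F x = x) (hend : ∀ b, ¬ A x b) (hε : 0 < ε) :
    ∃ a b z, A a b ∧ x - ε < a ∧ a < x ∧ x < b ∧ b < x + ε ∧ F z = z ∧ b < z ∧ z < a + T := by
  obtain ⟨z, hz, h1, h2⟩ := hF.exists_fixed hA hx hend
  obtain ⟨a, b, hab, h3, h4, h5, h6⟩ := hA.rainbow hend (min ε (min (z - x) (x + T - z)))
    (lt_min hε (lt_min (by linarith) (by linarith)))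
  have h7 := min_le_left ε (min (z - x) (x + T - z))
  have h8 := (min_le_right ε (min (z - x) (x + T - z))).trans (min_le_left _ _)
  have h9 := (min_le_right ε (min (z - x) (x + T - z))).trans (min_le_right _ _)
  exact ⟨a, b, z, hab, by linarith, h4, h5, by linarith, hz, by linarith, by linarith⟩

theorem fixed_iff_of_lt {a b x z : ℝ} (h : A a b) (hax : a < x) (hxb : x < b) (hx : F x = x)
    (hend : ∀ b, ¬ A x b) (hz : F z = z) (hbz : b < z) (hza : z < a + T) (hb : F b < b) :
    (∃ s, a ≤ s ∧ s < x ∧ F s = s) ↔ ∃ s, x < s ∧ s ≤ b ∧ F s = s := by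
  have ha := hF.lt_of_leaf' hA h hax hxb hx hz hbz hza hb
  have ub : ∀ n : ℕ, x ≤ F^[n] b := fun n => by
    have := (F.monotone.iterate n) hxb.le
    rwa [Function.iterate_fixed hx] at this
  have ua : ∀ n : ℕ, F^[n] a ≤ x := fun n => by
    have := (F.monotone.iterate n) hax.le
    rwa [Function.iterate_fixed hx] at this
  obtain ⟨b', hb1, hb2, hb3, hb4, -, hb5⟩ := tendsto_iterate_of_gt F hb ub
  obtain ⟨a', ha1, ha2, ha3, ha4, -, ha5⟩ := tendsto_iterate_of_lt F ha ua
  have hlim : a' < b' → A a' b' := fun hlt =>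
    hA.closed (hF.map_iterate h) ha1 hb1 hlt (by linarith)
  constructor
  · rintro ⟨s, hs1, hs2, hs3⟩
    have := ha5 s hs1 hs3
    refine ⟨b', lt_of_le_of_ne hb4 ?_, hb3.le, hb2⟩
    rintro rfl
    exact hend _ (hA.swap.2 (hlim (by linarith)))
  · rintro ⟨s, hs1, hs2, hs3⟩
    have := hb5 s hs2 hs3
    refine ⟨a', ha3.le, lt_of_le_of_ne ha4 ?_, ha2⟩
    rintro rfl
    exact hend _ (hlim (by linarith))

/-- Fixed points near a fixed point that is not an endpoint occur on both sides or on none: a small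
leaf around it converges under iteration to a fixed leaf, or to the point itself. -/
theorem fixed_iff {a b x z : ℝ} (h : A a b) (hax : a < x) (hxb : x < b) (hx : F x = x)
    (hend : ∀ b, ¬ A x b) (hz : F z = z) (hbz : b < z) (hza : z < a + T) :
    (∃ s, a ≤ s ∧ s < x ∧ F s = s) ↔ ∃ s, x < s ∧ s ≤ b ∧ F s = s := by
  rcases lt_trichotomy (F b) b with hb | hb | hb
  · exact hF.fixed_iff_of_lt hA h hax hxb hx hend hz hbz hza hb
  · exact ⟨fun _ => ⟨b, hxb, le_rfl, hb⟩, fun _ => ⟨a, le_rfl, hax, hF.fixed_left hA h hb⟩⟩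
  · have := hF.inv.fixed_iff_of_lt hA h hax hxb (inv_fixed.2 hx) hend (inv_fixed.2 hz) hbz hza
      (inv_lt_self.2 hb)
    simpa only [inv_fixed] using this

theorem isolated_of_right {x ε : ℝ} (hx : F x = x) (hend : ∀ b, ¬ A x b) (hε : 0 < ε)
    (h : ∀ s, x < s → s < x + ε → F s ≠ s) : IsolatedFixed F x := by
  obtain ⟨a, b, z, hab, h1, h2, h3, h4, hz, h5, h6⟩ := hF.exists_small_leaf hA hx hend hε
  have hiff := hF.fixed_iff hA hab h2 h3 hx hend hz h5 h6
  refine ⟨min ε (x - a), lt_min hε (by linarith), fun s hs1 hs2 hs3 => ?_⟩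
  have h7 := min_le_left ε (x - a)
  have h8 := min_le_right ε (x - a)
  rcases lt_trichotomy s x with hs | hs | hs
  · obtain ⟨r, hr1, hr2, hr3⟩ := hiff.1 ⟨s, by linarith, hs, hs3⟩
    exact absurd hr3 (h r hr1 (by linarith))
  · exact hs
  · exact absurd hs3 (h s hs (by linarith))

theorem isolated_of_left {x ε : ℝ} (hx : F x = x) (hend : ∀ b, ¬ A x b) (hε : 0 < ε)
    (h : ∀ s, x - ε < s → s < x → F s ≠ s) : IsolatedFixed F x := by
  obtain ⟨a, b, z, hab, h1, h2, h3, h4, hz, h5, h6⟩ := hF.exists_small_leaf hA hx hend hε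
  have hiff := hF.fixed_iff hA hab h2 h3 hx hend hz h5 h6
  refine ⟨min ε (b - x), lt_min hε (by linarith), fun s hs1 hs2 hs3 => ?_⟩
  have h7 := min_le_left ε (b - x)
  have h8 := min_le_right ε (b - x)
  rcases lt_trichotomy s x with hs | hs | hs
  · exact absurd hs3 (h s (by linarith) hs)
  · exact hs
  · obtain ⟨r, hr1, hr2, hr3⟩ := hiff.2 ⟨s, hs, by linarith, hs3⟩
    exact absurd hr3 (h r (by linarith) hr2)

theorem leaf_of_consec_of_lt {w x y a b : ℝ} (hwx : Consec F w x) (hxy : Consec F x y)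
    (h : A a b) (h1 : w < a) (h2 : a < x) (h3 : x < b) (h4 : b < y) (hyw : y ≤ w + T)
    (hb : b < F b) :
    (y = w + T ∨ A w y) ∧ (∀ t, w < t → t < x → F t < t) ∧ ∀ t, x < t → t < y → t < F t := by
  have ha := hF.lt_of_leaf hA h h2 h3 hwx.right hxy.right h4 (by linarith) hb
  have ub : ∀ n : ℕ, F^[n] b ≤ y := fun n => by
    have := (F.monotone.iterate n) h4.le
    rwa [Function.iterate_fixed hxy.right] at this
  have ua : ∀ n : ℕ, w ≤ F^[n] a := fun n => by
    have := (F.monotone.iterate n) h1.le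
    rwa [Function.iterate_fixed hwx.left] at this
  obtain ⟨b', hb1, hb2, hb3, hb4, -, -⟩ := tendsto_iterate_of_lt F hb ub
  obtain ⟨a', ha1, ha2, ha3, ha4, -, -⟩ := tendsto_iterate_of_gt F ha ua
  obtain rfl : b' = y := le_antisymm hb4 (hxy.unique_right hb2 (h3.trans hb3))
  obtain rfl : a' = w := le_antisymm (hwx.unique_left ha2 (ha3.trans h2)) ha4
  refine ⟨?_, ?_, ?_⟩
  · rcases hyw.eq_or_lt with heq | hlt
    · exact Or.inl heq
    · exact Or.inr (hA.closed (hF.map_iterate h) ha1 hb1 (by linarith) hlt)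
  · rcases sign_of_no_fixed hwx.between with hs | hs
    · exact absurd (hs a h1 h2) (not_lt.2 ha.le)
    · exact hs
  · rcases sign_of_no_fixed hxy.between with hs | hs
    · exact hs
    · exact absurd (hs b h3 h4) (not_lt.2 hb.le)

/-- The fixed points adjacent to a fixed point `x` that is not an endpoint are the only other fixed
point of the circle, or they span a leaf: the limit of a small leaf around `x` that is expanded.
Moreover `x` is attracting or repelling. -/
theorem leaf_of_consec {w x y : ℝ} (hwx : Consec F w x) (hxy : Consec F x y)
    (hend : ∀ b, ¬ A x b) : (y = w + T ∨ A w y) ∧ (Expands F w x y ∨ Expands F⁻¹ w x y) := by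
  obtain ⟨z, hz, hz1, hz2⟩ := hF.exists_fixed hA hxy.left hend
  have hyz := hxy.unique_right hz hz1
  have hzw := hwx.unique_left (hF.fixed_sub.2 hz) (by linarith)
  obtain ⟨a, b, hab, h1, h2, h3, h4⟩ := hA.rainbow hend (min (x - w) (y - x))
    (lt_min (by linarith [hwx.lt]) (by linarith [hxy.lt]))
  have h5 := min_le_left (x - w) (y - x)
  have h6 := min_le_right (x - w) (y - x)
  rcases lt_trichotomy (F b) b with hb | hb | hb
  · obtain ⟨h7, h8, h9⟩ := hF.inv.leaf_of_consec_of_lt hA hwx.inv hxy.inv hab (by linarith) h2 h3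
      (by linarith) (by linarith) (self_lt_inv.2 hb)
    exact ⟨h7, Or.inr ⟨hwx.lt, hxy.lt, inv_fixed.2 hxy.left, h8, h9⟩⟩
  · exact absurd hb (hxy.between b h3 (by linarith))
  · obtain ⟨h7, h8, h9⟩ := hF.leaf_of_consec_of_lt hA hwx hxy hab (by linarith) h2 h3
      (by linarith) (by linarith) hb
    exact ⟨h7, Or.inl ⟨hwx.lt, hxy.lt, hxy.left, h8, h9⟩⟩

theorem exists_fixed_between_of_lt {p q : ℝ} (hp : F p = p) (hq : F q = q) (h : A p q)
    (hlt : ∀ t, p < t → t < q → F t < t) : ∃ v, p < v ∧ v < q ∧ F v = v := by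
  rcases hA.side h with ⟨v, h1, h2, h3 | h3⟩ | hacc
  · exact ⟨v, h1, h2, hF.fixed_right hA h3 hp⟩
  · exact ⟨v, h1, h2, hF.fixed_left hA h3 hq⟩
  · obtain ⟨t, ht1, ht2⟩ := exists_between (hA.lt h)
    have h1 := F.strictMono ht1
    rw [hp] at h1
    obtain ⟨c, d, hcd, h2, h3, h4, h5⟩ := hacc (min (F t - p) (q - t))
      (lt_min (by linarith) (by linarith))
    have h6 := min_le_left (F t - p) (q - t)
    have h7 := min_le_right (F t - p) (q - t)
    have h8 := F.strictMono (show t < d by linarith)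
    have h9 := F.strictMono h2
    rw [hp] at h9
    have h10 := hA.lt hcd
    exact (hA.unlinked (hF.map.2 hcd) hcd (hlt c h2 (by linarith)) (by linarith)
      (hlt d (by linarith) h5) (by linarith [hA.lt_add h])).elim

/-- A fixed leaf has further fixed points on each side, since leaves that accumulate on it would
be pushed across themselves. -/
theorem exists_fixed_between {p q : ℝ} (hp : F p = p) (hq : F q = q) (h : A p q) :
    ∃ v, p < v ∧ v < q ∧ F v = v := by
  by_contra! hcon
  rcases sign_of_no_fixed hcon with hs | hs
  · obtain ⟨v, h1, h2, h3⟩ := hF.inv.exists_fixed_between_of_lt hA (inv_fixed.2 hp)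
      (inv_fixed.2 hq) h (fun t h1 h2 => inv_lt_self.2 (hs t h1 h2))
    exact hcon v h1 h2 (inv_fixed.1 h3)
  · obtain ⟨v, h1, h2, h3⟩ := hF.exists_fixed_between_of_lt hA hp hq h hs
    exact hcon v h1 h2 h3

end Preserves

/-! ### Fixed points of automorphisms of two transverse laminations -/

/-- Two laminations without common endpoints. -/
structure Transverse (T : ℝ) (A B : ℝ → ℝ → Prop) : Prop where
  fst : LineLam T A
  snd : LineLam T B
  disjoint : ∀ {t a b}, A t a → B t b → False

theorem Transverse.symm {T : ℝ} {A B : ℝ → ℝ → Prop} (h : Transverse T A B) : Transverse T B A :=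
  ⟨h.snd, h.fst, fun h1 h2 => h.disjoint h2 h1⟩

namespace Transverse

variable {T : ℝ} {A B : ℝ → ℝ → Prop} {F : ℝ ≃o ℝ} (hAB : Transverse T A B)
  (hA : Preserves T A F) (hB : Preserves T B F)
include hAB hA hB

theorem isolated_of_right {x ε : ℝ} (hx : F x = x) (hε : 0 < ε)
    (h : ∀ s, x < s → s < x + ε → F s ≠ s) : IsolatedFixed F x := by
  by_cases hend : ∀ b, ¬ A x b
  · exact hA.isolated_of_right hAB.fst hx hend hε h
  · push Not at hend
    obtain ⟨b, hb⟩ := hend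
    exact hB.isolated_of_right hAB.snd hx (fun c hc => hAB.disjoint hb hc) hε h

theorem isolated_of_left {x ε : ℝ} (hx : F x = x) (hε : 0 < ε)
    (h : ∀ s, x - ε < s → s < x → F s ≠ s) : IsolatedFixed F x := by
  by_cases hend : ∀ b, ¬ A x b
  · exact hA.isolated_of_left hAB.fst hx hend hε h
  · push Not at hend
    obtain ⟨b, hb⟩ := hend
    exact hB.isolated_of_left hAB.snd hx (fun c hc => hAB.disjoint hb hc) hε h

omit hB in
theorem consec_right {x : ℝ} (hx : F x = x) (h : IsolatedFixed F x) : ∃ y, Consec F x y := by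
  obtain ⟨ε, hε, h⟩ := h
  exact exists_consec_right hx hε (fun s h1 h2 h3 => h1.ne' (h s (by linarith) h2 h3))
    (hA.fixed_add.2 hx) (by linarith [hAB.fst.pos])

omit hB in
theorem consec_left {x : ℝ} (hx : F x = x) (h : IsolatedFixed F x) : ∃ y, Consec F y x := by
  obtain ⟨ε, hε, h⟩ := h
  exact exists_consec_left hx hε (fun s h1 h2 h3 => h2.ne (h s h1 (by linarith) h3))
    (hA.fixed_sub.2 hx) (by linarith [hAB.fst.pos])

/-- Isolated fixed points cannot converge from the left to a fixed point `d` that is not an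
endpoint: the fixed points before `d` are joined by a chain of leaves, which would be linked with
a small leaf around `d`, or share an endpoint with it. -/
theorem not_accumulate {x d : ℝ} (hxd : x < d) (hdx : d < x + T) (hx : F x = x)
    (hend : ∀ b, ¬ A d b) (hiso : ∀ s, x ≤ s → s < d → F s = s → IsolatedFixed F s)
    (hacc : ∀ ε > 0, ∃ s, d - ε < s ∧ s < d ∧ F s = s) : False := by
  obtain ⟨s₀, hs₀, hs₀d, hs₀F⟩ := hacc (d - x) (by linarith)
  obtain ⟨s₁, hs₁, hs₁d, hs₁F⟩ := hacc (d - s₀) (by linarith)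
  obtain ⟨c, e, hce, h1, h2, h3, h4⟩ := hAB.fst.rainbow hend (min (d - s₁) (x + T - d))
    (lt_min (by linarith) (by linarith))
  have h5 := min_le_left (d - s₁) (x + T - d)
  have h6 := min_le_right (d - s₁) (x + T - d)
  obtain ⟨u, ⟨⟨hu1, hu2⟩, hu3 : F u = u⟩, hu4⟩ :=
    (isCompact_Icc.inter_right (isClosed_fixed F)).exists_isGreatest
    (⟨s₁, ⟨le_rfl, by linarith⟩, hs₁F⟩ : (Icc s₁ c ∩ {s | F s = s}).Nonempty)
  obtain ⟨v, huv⟩ := hAB.consec_right hA hu3 (hiso u (by linarith) (by linarith) hu3)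
  have hcv : c < v := by
    by_contra! hvc
    exact absurd (hu4 ⟨⟨by linarith [huv.lt], hvc⟩, huv.right⟩) (not_le.2 huv.lt)
  obtain ⟨s₂, hs₂, hs₂d, hs₂F⟩ := hacc (d - c) (by linarith)
  have hvs₂ := huv.unique_right hs₂F (by linarith)
  obtain ⟨w, hvw⟩ := hAB.consec_right hA huv.right (hiso v (by linarith) (by linarith) huv.right)
  obtain ⟨s₃, hs₃, hs₃d, hs₃F⟩ := hacc (d - v) (by linarith)
  have hws₃ := hvw.unique_right hs₃F (by linarith)
  obtain ⟨u₁, hu₁⟩ := hAB.consec_left hA hu3 (hiso u (by linarith) (by linarith) hu3)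
  have hu₁s := hu₁.unique_left hs₀F (by linarith)
  obtain ⟨u₂, hu₂⟩ := hAB.consec_left hA hu₁.left
    (hiso u₁ (by linarith) (by linarith [hu₁.lt]) hu₁.left)
  have hu₂x := hu₂.unique_left hx (by linarith)
  have huv' := huv.lt
  have hvw' := hvw.lt
  have hu₁' := hu₁.lt
  have hu₂' := hu₂.lt
  by_cases huA : ∀ b, ¬ A u b
  · rcases (hA.leaf_of_consec hAB.fst hu₁ huv huA).1 with h7 | h7
    · linarith
    · exact hAB.fst.unlinked h7 hce (by linarith) hcv (by linarith) (by linarith)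
  · push Not at huA
    obtain ⟨b, hub⟩ := huA
    rcases (hB.leaf_of_consec hAB.snd hu₁ huv fun c hc => hAB.disjoint hub hc).1 with h7 | h7
    · linarith
    · have hvA : ∀ b, ¬ A v b := fun b hb => hAB.disjoint hb (hAB.snd.swap.2 h7)
      rcases (hA.leaf_of_consec hAB.fst huv hvw hvA).1 with h8 | h8
      · linarith
      · rcases hu2.eq_or_lt with rfl | huc
        · rcases (hA.leaf_of_consec hAB.fst hu₂ hu₁ fun b hb => hAB.disjoint hb h7).1 with h9 | h9
          · linarith
          · exact hAB.fst.three h8 hce (hAB.fst.swap.2 h9) (by linarith) (by linarith)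
        · exact hAB.fst.unlinked h8 hce huc (by linarith) (by linarith) (by linarith)

/-- If the fixed points are countable in number, they are isolated. -/
theorem isolatedFixed (hc : {s | F s = s}.Countable) {d : ℝ} (hd : F d = d) :
    IsolatedFixed F d := by
  by_contra hcon
  obtain ⟨x, hx, hxiso⟩ := exists_isolatedFixed hc hd
  have hT := hAB.fst.pos
  have hzs : ∀ n : ℤ, ∀ {t}, IsolatedFixed F (t + n • T) → IsolatedFixed F t := by
    rintro n t ⟨ε, hε, h⟩
    refine ⟨ε, hε, fun s h1 h2 h3 => ?_⟩
    have := h (s + n • T) (by linarith) (by linarith) ((hA.fixed_zsmul n).2 h3)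
    linarith
  obtain ⟨n, ⟨hn1, hn2⟩, -⟩ := existsUnique_add_zsmul_mem_Ico hT d x
  have hclosed : IsClosed {t | F t = t ∧ ¬ IsolatedFixed F t} := by
    rw [← isOpen_compl_iff, Metric.isOpen_iff]
    intro t ht
    simp only [mem_compl_iff, mem_ofPred_eq, not_and, not_not] at ht
    by_cases htF : F t = t
    · obtain ⟨ε, hε, h⟩ := ht htF
      refine ⟨ε, hε, fun s hs => ?_⟩
      rw [Metric.mem_ball, Real.dist_eq, abs_lt] at hs
      rintro ⟨h1, h2⟩
      obtain rfl := h s (by linarith) (by linarith) h1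
      exact h2 ⟨ε, hε, h⟩
    · obtain ⟨ε, hε, h⟩ := Metric.isOpen_iff.1 (isClosed_fixed F).isOpen_compl t htF
      exact ⟨ε, hε, fun s hs h1 => h hs h1.1⟩
  -- `e` is the first non-isolated fixed point after `x`
  obtain ⟨e, ⟨⟨he1, he2⟩, he3, he4⟩, he5⟩ := (isCompact_Icc.inter_right hclosed).exists_isLeast
    (⟨d + n • T, ⟨hn1, le_rfl⟩, (hA.fixed_zsmul n).2 hd, fun h => hcon (hzs n h)⟩ :
      (Icc x (d + n • T) ∩ {t | F t = t ∧ ¬ IsolatedFixed F t}).Nonempty)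
  have hxe : x < e := lt_of_le_of_ne he1 fun h => he4 (h ▸ hxiso)
  have hiso : ∀ s, x ≤ s → s < e → F s = s → IsolatedFixed F s := by
    intro s h1 h2 h3
    by_contra h4
    exact absurd (he5 ⟨⟨h1, h2.le.trans he2⟩, h3, h4⟩) (not_le.2 h2)
  have hacc : ∀ ε > 0, ∃ s, e - ε < s ∧ s < e ∧ F s = s := by
    intro ε hε
    by_contra! h
    exact he4 (hAB.isolated_of_left hA hB he3 hε h)
  by_cases hend : ∀ b, ¬ A e b
  · exact hAB.not_accumulate hA hB hxe (by linarith) hx hend hiso hacc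
  · push Not at hend
    obtain ⟨b, hb⟩ := hend
    exact hAB.symm.not_accumulate hB hA hxe (by linarith) hx
      (fun c hc => hAB.disjoint hb hc) hiso hacc

theorem expands_of_consec {w x y : ℝ} (hwx : Consec F w x) (hxy : Consec F x y) :
    Expands F w x y ∨ Expands F⁻¹ w x y := by
  by_cases hend : ∀ b, ¬ A x b
  · exact (hA.leaf_of_consec hAB.fst hwx hxy hend).2
  · push Not at hend
    obtain ⟨b, hb⟩ := hend
    exact (hB.leaf_of_consec hAB.snd hwx hxy fun c hc => hAB.disjoint hb hc).2

/-- Let `p` be a fixed point that is not an endpoint of `A`. If there is more than one other fixed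
point on the circle, then the first fixed point `y` after `p` is an endpoint of `A`, and `p` and the
next fixed point `q` after `y` span a leaf of `B`. -/
theorem expands_or_leaf (hc : {s | F s = s}.Countable) {p : ℝ} (hp : F p = p)
    (hend : ∀ b, ¬ A p b) :
    ∃ y, Consec F p y ∧ (Consec F y (p + T) ∨
      (∃ b, A y b) ∧ ∃ q, Consec F y q ∧ B p q) := by
  have hiso := fun {d} => hAB.isolatedFixed hA hB hc (d := d)
  obtain ⟨y, hy⟩ := hAB.consec_right hA hp (hiso hp)
  obtain ⟨w, hw⟩ := hAB.consec_left hA hp (hiso hp)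
  refine ⟨y, hy, ?_⟩
  rcases (hA.leaf_of_consec hAB.fst hw hy hend).1 with h1 | h1
  · left
    have := hA.consec_add hw
    rwa [← h1] at this
  · right
    have hyA := hAB.fst.swap.2 h1
    obtain ⟨q, hq⟩ := hAB.consec_right hA hy.right (hiso hy.right)
    refine ⟨⟨_, hyA⟩, q, hq, ?_⟩
    rcases (hB.leaf_of_consec hAB.snd hy hq fun c hc => hAB.disjoint hyA hc).1 with h2 | h2
    · exact absurd (hA.fixed_add.2 hw.left)
        (hq.between _ (hAB.fst.lt_add h1) (by linarith [hw.lt]))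
    · exact h2

end Transverse

/-- A group of automorphisms of two transverse laminations is abelian if it fixes a point and its
nontrivial elements have countably many fixed points. -/
theorem commute_of_fixed {T : ℝ} {A B : ℝ → ℝ → Prop} (hAB : Transverse T A B)
    (Γ : Subgroup (ℝ ≃o ℝ)) (hA : ∀ F ∈ Γ, Preserves T A F) (hB : ∀ F ∈ Γ, Preserves T B F)
    {p : ℝ} (hp : ∀ F ∈ Γ, F p = p) (hend : ∀ b, ¬ A p b)
    (hc : ∀ F ∈ Γ, F ≠ 1 → {s | F s = s}.Countable)
    (f : ℝ ≃o ℝ) (hf : f ∈ Γ) (h : ℝ ≃o ℝ) (hh : h ∈ Γ) : f * h = h * f := by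
  by_cases hall : ∀ F ∈ Γ, F ≠ 1 → ∃ y, Consec F p y ∧ Consec F y (p + T)
  · refine commute_of_expands Γ hp (fun F hF => (hA F hF).fixed_add.2 (hp F hF)) ?_ f hf h hh
    intro F hF hne
    obtain ⟨y, h1, h2⟩ := hall F hF hne
    exact ⟨y, hAB.expands_of_consec (hA F hF) (hB F hF) h1 h2⟩
  · push Not at hall
    obtain ⟨g, hg, hg1, hgy⟩ := hall
    obtain ⟨x, hx, h1 | ⟨⟨b, hxb⟩, q, hxq, hpq⟩⟩ :=
      hAB.expands_or_leaf (hA g hg) (hB g hg) (hc g hg hg1) (hp g hg) hend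
    · exact absurd h1 (hgy x hx)
    have hq : ∀ F ∈ Γ, F q = q := fun F hF => (hB F hF).fixed_right hAB.snd hpq (hp F hF)
    refine commute_of_expands Γ hp hq ?_ f hf h hh
    intro F hF hne
    obtain ⟨y, hy, h2⟩ := hAB.expands_or_leaf (hA F hF) (hB F hF) (hc F hF hne) (hp F hF) hend
    obtain ⟨v, hpv, hvq, hv⟩ := (hB F hF).exists_fixed_between hAB.snd (hp F hF) (hq F hF) hpq
    have hyv := hy.unique_right hv hpv
    rcases h2 with h2 | ⟨⟨b', hyb⟩, r, hyr, hpr⟩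
    · exact absurd (hq F hF) (h2.between q (by linarith) (hAB.snd.lt_add hpq))
    · have hrq := hyr.unique_right (hq F hF) (by linarith)
      rcases hrq.eq_or_lt with rfl | hrq
      · exact ⟨y, hAB.expands_of_consec (hA F hF) (hB F hF) hy hyr⟩
      · -- `r` would be a fixed point of `g` between `p` and `q`
        have hgr : g r = r := (hB g hg).fixed_right hAB.snd hpr (hp g hg)
        have h3 := hx.unique_right hgr (by linarith [hy.lt, hyr.lt])
        have h4 := hxq.unique_left hgr hrq
        obtain rfl := le_antisymm h3 h4
        exact (hAB.disjoint hxb (hAB.snd.swap.2 hpr)).elim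

open Real

/-! ### Chords of the disk -/

/-- The signed distance from `z` to the line through the circle points at angles `a` and `b`,
positive on the arc from `a` to `b`. -/
noncomputable def level (a b : ℝ) (z : ℂ) : ℝ :=
  z.re * cos ((a + b) / 2) + z.im * sin ((a + b) / 2) - cos ((b - a) / 2)

theorem exp_re (t : ℝ) : (Circle.exp t : ℂ).re = cos t := by
  rw [Circle.coe_exp, Complex.exp_ofReal_mul_I_re]

theorem exp_im (t : ℝ) : (Circle.exp t : ℂ).im = sin t := by
  rw [Circle.coe_exp, Complex.exp_ofReal_mul_I_im]

theorem level_exp (a b t : ℝ) :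
    level a b (Circle.exp t) = 2 * sin ((t - a) / 2) * sin ((b - t) / 2) := by
  rw [level, exp_re, exp_im, ← cos_sub, cos_sub_cos]
  rw [show (t - (a + b) / 2 + (b - a) / 2) / 2 = (t - a) / 2 by ring,
    show (t - (a + b) / 2 - (b - a) / 2) / 2 = -((b - t) / 2) by ring, sin_neg]
  ring

theorem level_left (a b : ℝ) : level a b (Circle.exp a) = 0 := by
  rw [level_exp]; simp

theorem level_right (a b : ℝ) : level a b (Circle.exp b) = 0 := by
  rw [level_exp]; simp

theorem level_pos {a b t : ℝ} (h1 : a < t) (h2 : t < b) (h3 : b < a + 2 * π) :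
    0 < level a b (Circle.exp t) := by
  rw [level_exp]
  have := sin_pos_of_pos_of_lt_pi (x := (t - a) / 2) (by linarith) (by linarith)
  have := sin_pos_of_pos_of_lt_pi (x := (b - t) / 2) (by linarith) (by linarith)
  positivity

theorem level_neg {a b t : ℝ} (h1 : a < b) (h2 : b < t) (h3 : t < a + 2 * π) :
    level a b (Circle.exp t) < 0 := by
  rw [level_exp]
  have := sin_pos_of_pos_of_lt_pi (x := (t - a) / 2) (by linarith) (by linarith)
  have := sin_neg_of_neg_of_neg_pi_lt (x := (b - t) / 2) (by linarith) (by linarith)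
  exact mul_neg_of_pos_of_neg (by positivity) this

theorem continuous_level (a b : ℝ) : Continuous (level a b) := by
  unfold level; fun_prop

theorem level_comb (a b : ℝ) {x y : ℝ} (h : x + y = 1) (u v : ℂ) :
    level a b (x • u + y • v) = x * level a b u + y * level a b v := by
  simp only [level, Complex.add_re, Complex.add_im, Complex.real_smul, Complex.re_ofReal_mul,
    Complex.im_ofReal_mul]
  linear_combination cos ((b - a) / 2) * h

theorem convex_level_nonpos (a b : ℝ) : Convex ℝ {z | level a b z ≤ 0} := by
  intro u hu v hv x y hx hy h
  have hu : level a b u ≤ 0 := hu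
  have hv : level a b v ≤ 0 := hv
  change level a b _ ≤ 0
  rw [level_comb a b h]
  nlinarith

theorem level_of_mem_segment {a b : ℝ} {z : ℂ}
    (hz : z ∈ segment ℝ (Circle.exp a : ℂ) (Circle.exp b)) : level a b z = 0 := by
  obtain ⟨x, y, hx, hy, h, rfl⟩ := hz
  rw [level_comb a b h, level_left, level_right]
  ring

theorem mem_segment_of_level {a b : ℝ} {z : ℂ} (hab : a < b) (hba : b < a + 2 * π)
    (hz : ‖z‖ < 1) (h : level a b z = 0) :
    z ∈ segment ℝ (Circle.exp a : ℂ) (Circle.exp b) := by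
  set m := (a + b) / 2 with hm
  set δ := (b - a) / 2 with hδ
  have ha : a = m - δ := by rw [hm, hδ]; ring
  have hb : b = m + δ := by rw [hm, hδ]; ring
  have hsin : 0 < sin δ := sin_pos_of_pos_of_lt_pi (by linarith) (by linarith)
  set s := -z.re * sin m + z.im * cos m with hs
  have hl : z.re * cos m + z.im * sin m = cos δ := by
    have : level a b z = z.re * cos m + z.im * sin m - cos δ := rfl
    linarith
  have hcs := sin_sq_add_cos_sq m
  have hre : z.re = cos δ * cos m - s * sin m := by
    rw [← hl, hs]; linear_combination (-z.re) * hcs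
  have him : z.im = cos δ * sin m + s * cos m := by
    rw [← hl, hs]; linear_combination (-z.im) * hcs
  have hnorm : z.re ^ 2 + z.im ^ 2 < 1 := by
    have h1 : ‖z‖ ^ 2 < 1 := by nlinarith [norm_nonneg z]
    rw [Complex.sq_norm, Complex.normSq_apply] at h1
    nlinarith
  have hs2 : s ^ 2 < sin δ ^ 2 := by
    have h1 : z.re ^ 2 + z.im ^ 2 = cos δ ^ 2 + s ^ 2 := by
      rw [hre, him]; linear_combination (cos δ ^ 2 + s ^ 2) * hcs
    nlinarith [sin_sq_add_cos_sq δ]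
  have habs := abs_lt_of_sq_lt_sq hs2 hsin.le
  rw [abs_lt] at habs
  refine ⟨(1 - s / sin δ) / 2, (1 + s / sin δ) / 2, ?_, ?_, by ring, ?_⟩
  · have : s / sin δ ≤ 1 := by rw [div_le_one hsin]; exact habs.2.le
    linarith
  · have : -1 ≤ s / sin δ := by rw [le_div_iff₀ hsin]; linarith
    linarith
  · apply Complex.ext
    · simp only [Complex.add_re, Complex.real_smul, Complex.re_ofReal_mul, exp_re]
      rw [ha, hb, cos_sub, cos_add, hre]
      field_simp
      ring
    · simp only [Complex.add_im, Complex.real_smul, Complex.im_ofReal_mul, exp_im]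
      rw [ha, hb, sin_sub, sin_add, him]
      field_simp
      ring

/-- Every point of the circle has an angle in a given period. -/
theorem exists_angle (θ : ℝ) (x : Circle) :
    ∃ t, θ ≤ t ∧ t < θ + 2 * π ∧ Circle.exp t = x := by
  obtain ⟨s, rfl⟩ := Circle.exp_surjective x
  obtain ⟨n, ⟨h1, h2⟩, -⟩ := existsUnique_add_zsmul_mem_Ico two_pi_pos s θ
  exact ⟨_, h1, h2, Circle.exp_eq_exp.2 ⟨n, by simp⟩⟩

theorem exp_ne_exp {a b : ℝ} (h1 : a < b) (h2 : b < a + 2 * π) : Circle.exp a ≠ Circle.exp b := by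
  intro h
  have := Circle.exp_injOn_Ico (a := a) (b := a + 2 * π) (by linarith) ⟨le_rfl, by linarith⟩
    ⟨h1.le, h2⟩ h
  exact h1.ne this

theorem exists_of_level_pos {a b : ℝ} (hab : a < b) (x : Circle) (h : 0 < level a b x) :
    ∃ t, a < t ∧ t < b ∧ Circle.exp t = x := by
  obtain ⟨t, h1, h2, rfl⟩ := exists_angle a x
  refine ⟨t, lt_of_le_of_ne h1 ?_, ?_, rfl⟩
  · rintro rfl
    rw [level_left] at h
    exact lt_irrefl _ h
  · by_contra! hbt
    rcases hbt.eq_or_lt with rfl | hbt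
    · rw [level_right] at h
      exact lt_irrefl _ h
    · exact lt_asymm h (level_neg hab hbt h2)

theorem exists_of_level_neg {a b : ℝ} (hba : b < a + 2 * π) (x : Circle) (h : level a b x < 0) :
    ∃ t, b < t ∧ t < a + 2 * π ∧ Circle.exp t = x := by
  obtain ⟨t, h1, h2, rfl⟩ := exists_angle a x
  refine ⟨t, ?_, h2, rfl⟩
  by_contra! hbt
  rcases h1.eq_or_lt with rfl | h1
  · rw [level_left] at h
    exact lt_irrefl _ h
  · rcases hbt.eq_or_lt with rfl | hbt
    · rw [level_right] at h
      exact lt_irrefl _ h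
    · exact lt_asymm h (level_pos h1 hbt hba)

theorem eq_of_level {a b : ℝ} (hab : a < b) (hba : b < a + 2 * π) (x : Circle)
    (h : level a b x = 0) : x = Circle.exp a ∨ x = Circle.exp b := by
  obtain ⟨t, h1, h2, rfl⟩ := exists_angle a x
  rcases h1.eq_or_lt with rfl | h1
  · exact Or.inl rfl
  · rcases lt_trichotomy t b with hbt | rfl | hbt
    · exact absurd h (level_pos h1 hbt hba).ne'
    · exact Or.inr rfl
    · exact absurd h (level_neg hab hbt h2).ne

theorem linked_of_lt {a b c d : ℝ} (h1 : a < c) (h2 : c < b) (h3 : b < d) (h4 : d < a + 2 * π) :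
    Linked (Circle.exp a) (Circle.exp b) (Circle.exp c) (Circle.exp d) := by
  have hab := h1.trans h2
  have hba := h3.trans h4
  have hcont : Continuous fun z : Circle => level a b z :=
    (continuous_level a b).comp continuous_subtype_val
  have hne : ∀ z ∈ ({Circle.exp a, Circle.exp b} : Set Circle)ᶜ, level a b z ≠ 0 :=
    fun z hz h0 => hz (eq_of_level hab hba z h0)
  -- the level does not change sign on a component
  have hsep : ∀ x y z, y ∈ connectedComponentIn ({Circle.exp a, Circle.exp b} : Set Circle)ᶜ x →
      z ∈ connectedComponentIn ({Circle.exp a, Circle.exp b} : Set Circle)ᶜ x →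
      level a b y < 0 → 0 < level a b z → False := by
    intro x y z hy hz h5 h6
    obtain ⟨w, hw, hw0⟩ := isPreconnected_connectedComponentIn.intermediate_value hy hz
      hcont.continuousOn (show (0 : ℝ) ∈ Icc _ _ from ⟨h5.le, h6.le⟩)
    exact hne w (connectedComponentIn_subset _ _ hw) hw0
  have hin : ∀ r s, (∀ t ∈ Ioo r s, level a b (Circle.exp t) ≠ 0) → ∀ t ∈ Ioo r s, ∀ t' ∈ Ioo r s,
      Circle.exp t' ∈ connectedComponentIn ({Circle.exp a, Circle.exp b} : Set Circle)ᶜ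
        (Circle.exp t) := by
    intro r s h0 t ht t' ht'
    refine (isPreconnected_Ioo.image _
      Circle.exp.continuous.continuousOn).subset_connectedComponentIn (mem_image_of_mem _ ht) ?_
      (mem_image_of_mem _ ht')
    rintro _ ⟨r', hr', rfl⟩ (h5 | h5)
    · exact h0 r' hr' (by rw [h5, level_left])
    · exact h0 r' hr' (by rw [h5, level_right])
  intro x hx
  have hxx := mem_connectedComponentIn hx
  rcases lt_or_gt_of_ne (hne x hx) with h5 | h5
  · obtain ⟨t, ht1, ht2, rfl⟩ := exists_of_level_neg hba x h5
    refine Or.inr ⟨hin b (a + 2 * π) (fun t ht => (level_neg hab ht.1 ht.2).ne) t ⟨ht1, ht2⟩ d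
      ⟨h3, h4⟩, fun hc => hsep _ _ _ hxx hc h5 (level_pos h1 h2 hba)⟩
  · obtain ⟨t, ht1, ht2, rfl⟩ := exists_of_level_pos hab x h5
    refine Or.inl ⟨hin a b (fun t ht => (level_pos ht.1 ht.2 hba).ne') t ⟨ht1, ht2⟩ c
      ⟨h1, h2⟩, fun hd => hsep _ _ _ hd hxx (level_neg hab h3 h4) h5⟩

/-- A point of the circle in the convex hull of a set of points of the circle is one of them. -/
theorem mem_of_mem_convexHull {V : Finset Circle} {x : Circle}
    (hx : (x : ℂ) ∈ convexHull ℝ ((fun v : Circle => (v : ℂ)) '' (V : Set Circle))) : x ∈ V := by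
  by_contra hxV
  have hsq : ∀ v : Circle, (v : ℂ).re ^ 2 + (v : ℂ).im ^ 2 = 1 := fun v => by
    have := Circle.normSq_coe v
    rw [Complex.normSq_apply] at this
    nlinarith
  have hconv : Convex ℝ {z : ℂ | z.re * (x : ℂ).re + z.im * (x : ℂ).im < 1} := by
    intro u hu v hv a b ha hb h
    simp only [mem_ofPred_eq, Complex.add_re, Complex.add_im, Complex.real_smul,
      Complex.re_ofReal_mul, Complex.im_ofReal_mul] at hu hv ⊢
    have : a * (u.re * (x : ℂ).re + u.im * (x : ℂ).im) +
        b * (v.re * (x : ℂ).re + v.im * (x : ℂ).im) < 1 := by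
      rcases ha.eq_or_lt with rfl | ha
      · have : b = 1 := by linarith
        subst this; linarith
      · nlinarith
    linarith
  have hsub : (fun v : Circle => (v : ℂ)) '' (V : Set Circle) ⊆
      {z : ℂ | z.re * (x : ℂ).re + z.im * (x : ℂ).im < 1} := by
    rintro _ ⟨v, hv, rfl⟩
    simp only [mem_ofPred_eq]
    by_contra! hle
    have h1 := hsq x
    have h2 := hsq v
    have h3 : ((v : ℂ).re - (x : ℂ).re) ^ 2 + ((v : ℂ).im - (x : ℂ).im) ^ 2 ≤ 0 := by nlinarith
    have h4 : (v : ℂ).re = (x : ℂ).re := by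
      nlinarith [sq_nonneg ((v : ℂ).re - (x : ℂ).re), sq_nonneg ((v : ℂ).im - (x : ℂ).im)]
    have h5 : (v : ℂ).im = (x : ℂ).im := by
      nlinarith [sq_nonneg ((v : ℂ).re - (x : ℂ).re), sq_nonneg ((v : ℂ).im - (x : ℂ).im)]
    have : v = x := Subtype.ext (Complex.ext h4 h5)
    exact hxV (this ▸ hv)
  have := convexHull_min hsub hconv hx
  simp only [mem_ofPred_eq] at this
  nlinarith [hsq x]

/-! ### Leaves and gaps in the disk -/

namespace Lamination

variable (L : Lamination)

/-- The leaves, as ordered pairs, together with the diagonal. -/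
def pairs : Set (Circle × Circle) := {p | s(p.1, p.2) ∈ L.leaves ∨ p.1 = p.2}

/-- The union of the chords that join the pairs in `D`. -/
def hull (D : Set (Circle × Circle)) : Set ℂ :=
  {z | ∃ p ∈ D, z ∈ segment ℝ (p.1 : ℂ) (p.2 : ℂ)}

/-- The lift of a lamination to the universal cover: `a < b < a + 2π` are angles of the endpoints
of a leaf. -/
def lift (a b : ℝ) : Prop :=
  a < b ∧ b < a + 2 * π ∧ s(Circle.exp a, Circle.exp b) ∈ L.leaves

variable {L}

theorem isClosed_pairs : IsClosed L.pairs := by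
  obtain ⟨t, ht, h⟩ := isClosed_induced_iff.1 L.isClosed
  have : L.pairs = t ∪ diagonal Circle := by
    ext ⟨x, y⟩
    by_cases hxy : x = y
    · simp [pairs, hxy]
    · have := Set.ext_iff.1 h ⟨(x, y), hxy⟩
      simp only [mem_preimage, mem_ofPred_eq] at this
      simp [pairs, hxy, this]
  rw [this]
  exact ht.union isClosed_diagonal

theorem isClosed_hull {D : Set (Circle × Circle)} (hD : IsClosed D) : IsClosed (hull D) := by
  have hc : IsCompact (D ×ˢ Icc (0 : ℝ) 1) := hD.isCompact.prod isCompact_Icc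
  have : hull D = (fun p : (Circle × Circle) × ℝ =>
      (1 - p.2) • (p.1.1 : ℂ) + p.2 • (p.1.2 : ℂ)) '' (D ×ˢ Icc (0 : ℝ) 1) := by
    ext z
    simp only [hull, mem_ofPred_eq, segment_eq_image, mem_image, mem_prod, Prod.exists]
    constructor
    · rintro ⟨x, y, h, t, ht, rfl⟩
      exact ⟨x, y, t, ⟨h, ht⟩, rfl⟩
    · rintro ⟨x, y, t, ⟨h, ht⟩, rfl⟩
      exact ⟨x, y, h, t, ht, rfl⟩
  rw [this]
  refine (hc.image ?_).isClosed
  fun_prop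

theorem norm_lt_one_of_segment {x y : Circle} (hxy : x = y) {z : ℂ}
    (hz : z ∈ segment ℝ (x : ℂ) (y : ℂ)) : ¬ ‖z‖ < 1 := by
  subst hxy
  rw [segment_same] at hz
  rw [mem_singleton_iff.1 hz, Circle.norm_coe]
  exact lt_irrefl _

theorem mem_support {z : ℂ} : z ∈ L.support ↔
    ∃ x y : Circle, s(x, y) ∈ L.leaves ∧ z ∈ segment ℝ (x : ℂ) (y : ℂ) := by
  simp only [support, mem_iUnion, exists_prop]
  constructor
  · rintro ⟨l, hl, hz⟩
    induction l using Sym2.ind with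
    | _ x y => exact ⟨x, y, hl, hz⟩
  · rintro ⟨x, y, hl, hz⟩
    exact ⟨s(x, y), hl, hz⟩

theorem isOpen_compl : IsOpen (Metric.ball (0 : ℂ) 1 \ L.support) := by
  have : Metric.ball (0 : ℂ) 1 \ L.support = Metric.ball (0 : ℂ) 1 ∩ (hull L.pairs)ᶜ := by
    ext z
    simp only [Set.mem_sdiff, mem_inter_iff, mem_compl_iff, mem_support, mem_ball_zero_iff]
    refine and_congr_right fun hz => not_congr ?_
    constructor
    · rintro ⟨x, y, h1, h2⟩
      exact ⟨(x, y), Or.inl h1, h2⟩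
    · rintro ⟨⟨x, y⟩, h1 | h1, h2⟩
      · exact ⟨x, y, h1, h2⟩
      · exact absurd hz (norm_lt_one_of_segment h1 h2)
  rw [this]
  exact Metric.isOpen_ball.inter (isClosed_hull isClosed_pairs).isOpen_compl

theorem ne_of_leaf {x y : Circle} (h : s(x, y) ∈ L.leaves) : x ≠ y :=
  fun hxy => L.not_isDiag _ h (Sym2.mk_isDiag_iff.2 hxy)

theorem exists_lift {x y : Circle} (h : s(x, y) ∈ L.leaves) (θ : ℝ) (hx : Circle.exp θ = x) :
    ∃ b, L.lift θ b ∧ Circle.exp b = y := by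
  obtain ⟨b, h1, h2, h3⟩ := exists_angle θ y
  refine ⟨b, ⟨lt_of_le_of_ne h1 ?_, h2, by rwa [hx, h3]⟩, h3⟩
  rintro rfl
  exact ne_of_leaf h (hx.symm.trans h3)

theorem lift_swap {a b : ℝ} : L.lift b (a + 2 * π) ↔ L.lift a b := by
  unfold lift
  rw [Circle.exp_add_two_pi, Sym2.eq_swap]
  constructor
  · rintro ⟨h1, h2, h3⟩; exact ⟨by linarith, by linarith, h3⟩
  · rintro ⟨h1, h2, h3⟩; exact ⟨by linarith, by linarith, h3⟩

theorem lift_unlinked {a b c d : ℝ} (h : L.lift a b) (h' : L.lift c d) (h1 : a < c) (h2 : c < b)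
    (h3 : b < d) (h4 : d < a + 2 * π) : False :=
  L.unlinked _ _ _ _ h.2.2 h'.2.2 (linked_of_lt h1 h2 h3 h4)

/-- A leaf has its two endpoints on the same side of every other leaf. -/
theorem not_level_lt {a b : ℝ} (h : L.lift a b) {x y : Circle} (hxy : s(x, y) ∈ L.leaves)
    (hx : 0 < level a b x) (hy : level a b y < 0) : False := by
  obtain ⟨t, h1, h2, rfl⟩ := exists_of_level_pos h.1 x hx
  obtain ⟨r, h3, h4, rfl⟩ := exists_of_level_neg h.2.1 y hy
  exact L.unlinked _ _ _ _ h.2.2 hxy (linked_of_lt h1 h2 h3 h4)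

/-- Chords of leaves that meet inside the disk coincide. -/
theorem eq_of_meet {a b : ℝ} (h : L.lift a b) {x y : Circle} (hxy : s(x, y) ∈ L.leaves) {z : ℂ}
    (hz : ‖z‖ < 1) (hz0 : level a b z = 0) (hzxy : z ∈ segment ℝ (x : ℂ) (y : ℂ)) :
    s(x, y) = s(Circle.exp a, Circle.exp b) := by
  obtain ⟨α, β, hα, hβ, hαβ, rfl⟩ := hzxy
  rw [level_comb a b hαβ] at hz0
  have hα' : α ≠ 0 := by
    rintro rfl
    have : β = 1 := by linarith
    subst this
    rw [zero_smul, one_smul, zero_add, Circle.norm_coe] at hz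
    exact lt_irrefl _ hz
  have hβ' : β ≠ 0 := by
    rintro rfl
    have : α = 1 := by linarith
    subst this
    rw [zero_smul, one_smul, add_zero, Circle.norm_coe] at hz
    exact lt_irrefl _ hz
  have hα : 0 < α := lt_of_le_of_ne hα hα'.symm
  have hβ : 0 < β := lt_of_le_of_ne hβ hβ'.symm
  have hne := ne_of_leaf hxy
  rcases lt_trichotomy (level a b x) 0 with hx | hx | hx
  · have hy : 0 < level a b y := by by_contra! hy; nlinarith
    exact (not_level_lt h (by rwa [Sym2.eq_swap]) hy hx).elim
  · have hy : level a b y = 0 := by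
      rw [hx, mul_zero, zero_add] at hz0
      exact (mul_eq_zero.1 hz0).resolve_left hβ'
    rcases eq_of_level h.1 h.2.1 x hx with rfl | rfl <;>
      rcases eq_of_level h.1 h.2.1 y hy with rfl | rfl
    · exact absurd rfl hne
    · rfl
    · exact Sym2.eq_swap
    · exact absurd rfl hne
  · have hy : level a b y < 0 := by by_contra! hy; nlinarith
    exact (not_level_lt h hxy hx hy).elim

variable (L) in
/-- The complementary region of the leaves that contains `z`; gaps are the closures of these. -/
abbrev region (z : ℂ) : Set ℂ := connectedComponentIn (Metric.ball (0 : ℂ) 1 \ L.support) z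

/-- A gap lies on one side of every leaf. -/
theorem gap_side {a b : ℝ} (h : L.lift a b) (z₀ : ℂ) :
    (∀ z ∈ closure (L.region z₀), 0 ≤ level a b z) ∨
    ∀ z ∈ closure (L.region z₀), level a b z ≤ 0 := by
  have hne : ∀ z ∈ L.region z₀,
      level a b z ≠ 0 := by
    intro z hz h0
    obtain ⟨hz1, hz2⟩ := connectedComponentIn_subset _ _ hz
    exact hz2 (mem_support.2 ⟨_, _, h.2.2,
      mem_segment_of_level h.1 h.2.1 (mem_ball_zero_iff.1 hz1) h0⟩)
  by_cases hex : ∃ z ∈ L.region z₀, level a b z < 0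
  · obtain ⟨z, hz, hz0⟩ := hex
    right
    refine fun w hw => closure_minimal (t := {z | level a b z ≤ 0}) ?_
      (isClosed_le (continuous_level a b) continuous_const) hw
    intro w hw
    by_contra hlt
    obtain ⟨v, hv, hv0⟩ := isPreconnected_connectedComponentIn.intermediate_value hz hw
      (continuous_level a b).continuousOn
      (show (0 : ℝ) ∈ Icc _ _ from ⟨hz0.le, (not_le.1 hlt).le⟩)
    exact hne v hv hv0
  · push Not at hex
    left
    exact fun w hw => closure_minimal (t := {z | 0 ≤ level a b z}) hex
      (isClosed_le continuous_const (continuous_level a b)) hw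

/-- The midpoint of the chord between the angles `a` and `b`. -/
noncomputable def midpt (a b : ℝ) : ℂ :=
  (1 / 2 : ℝ) • (Circle.exp a : ℂ) + (1 / 2 : ℝ) • (Circle.exp b : ℂ)

/-- The point at signed distance `s` from the midpoint of a chord, on the perpendicular to it. -/
noncomputable def offset (a b s : ℝ) : ℂ := midpt a b + (s : ℂ) * (Circle.exp ((a + b) / 2) : ℂ)

theorem level_midpt (a b : ℝ) : level a b (midpt a b) = 0 := by
  rw [midpt, level_comb a b (by norm_num), level_left, level_right]; ring

theorem level_offset (a b s : ℝ) : level a b (offset a b s) = s := by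
  have h := level_midpt a b
  simp only [level, offset, Complex.add_re, Complex.add_im, Complex.re_ofReal_mul,
    Complex.im_ofReal_mul, exp_re, exp_im] at h ⊢
  linear_combination h + s * sin_sq_add_cos_sq ((a + b) / 2)

theorem continuous_offset (a b : ℝ) : Continuous (offset a b) := by
  unfold offset; fun_prop

theorem offset_zero (a b : ℝ) : offset a b 0 = midpt a b := by simp [offset]

theorem norm_midpt {a b : ℝ} (h1 : a < b) (h2 : b < a + 2 * π) : ‖midpt a b‖ < 1 := by
  have hne : (Circle.exp a : ℂ) ≠ Circle.exp b := fun h => exp_ne_exp h1 h2 (Subtype.ext h)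
  have := norm_combo_lt_of_ne (r := 1) (Circle.norm_coe (Circle.exp a)).le
    (Circle.norm_coe (Circle.exp b)).le hne (a := 1 / 2) (b := 1 / 2) (by norm_num) (by norm_num)
    (by norm_num)
  exact this

/-- An edge of the convex hull of a gap is a leaf: its midpoint is on the boundary of the gap, so it
is on some leaf, and the gap lies on one side of that leaf. -/
theorem edge_mem {z₀ : ℂ} {a b : ℝ} (h1 : a < b) (h2 : b < a + 2 * π)
    (hconv : Convex ℝ (closure (L.region z₀)))
    (ha : (Circle.exp a : ℂ) ∈ closure (L.region z₀))
    (hb : (Circle.exp b : ℂ) ∈ closure (L.region z₀))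
    (hle : ∀ z ∈ closure (L.region z₀),
      level a b z ≤ 0) : L.lift a b := by
  have hm := norm_midpt h1 h2
  have hw : midpt a b ∈ closure (L.region z₀) :=
    hconv ha hb (by norm_num) (by norm_num) (by norm_num)
  have hsup : midpt a b ∈ L.support := by
    by_contra hns
    have hmem : midpt a b ∈ Metric.ball (0 : ℂ) 1 \ L.support := ⟨mem_ball_zero_iff.2 hm, hns⟩
    have hopen := isOpen_compl (L := L).connectedComponentIn (x := midpt a b)
    have hself := mem_connectedComponentIn hmem
    obtain ⟨v, hv1, hv2⟩ := mem_closure_iff.1 hw _ hopen hself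
    have heq : L.region (midpt a b) = L.region z₀ :=
      (connectedComponentIn_eq hv1).trans (connectedComponentIn_eq hv2).symm
    have hnhds : offset a b ⁻¹' L.region (midpt a b) ∈ 𝓝 0 :=
      (hopen.preimage (continuous_offset a b)).mem_nhds (by rwa [mem_preimage, offset_zero])
    obtain ⟨ε, hε, hsub⟩ := Metric.mem_nhds_iff.1 hnhds
    have h3 : offset a b (ε / 2) ∈ L.region (midpt a b) := hsub (by
      rw [Metric.mem_ball, Real.dist_eq, sub_zero, abs_of_pos (by linarith)]; linarith)
    rw [heq] at h3
    have := hle _ (subset_closure h3)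
    rw [level_offset] at this
    linarith
  obtain ⟨x, y, hxy, hseg⟩ := mem_support.1 hsup
  obtain ⟨c, rfl⟩ := Circle.exp_surjective x
  obtain ⟨d, hcd, rfl⟩ := exists_lift hxy c rfl
  have h0 := level_of_mem_segment hseg
  rw [midpt, level_comb c d (by norm_num)] at h0
  have h3 : level c d (Circle.exp a) = 0 ∧ level c d (Circle.exp b) = 0 := by
    rcases gap_side hcd z₀ with hs | hs
    · have h4 := hs _ ha
      have h5 := hs _ hb
      constructor <;> linarith
    · have h4 := hs _ ha
      have h5 := hs _ hb
      constructor <;> linarith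
  refine ⟨h1, h2, ?_⟩
  have hne := exp_ne_exp h1 h2
  rcases eq_of_level hcd.1 hcd.2.1 _ h3.1 with e1 | e1 <;>
    rcases eq_of_level hcd.1 hcd.2.1 _ h3.2 with e2 | e2
  · exact absurd (e1.trans e2.symm) hne
  · rwa [e1, e2]
  · rw [e1, e2, Sym2.eq_swap]; exact hxy
  · exact absurd (e1.trans e2.symm) hne

/-- From a vertex `θ` of a polygonal gap the edge to the next vertex `a` is a leaf. -/
theorem exists_edge {z₀ : ℂ} {V : Finset Circle} (hV : 3 ≤ V.card)
    (hP : closure (L.region z₀) =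
      convexHull ℝ ((fun v : Circle => (v : ℂ)) '' (V : Set Circle)))
    {θ : ℝ} (hθ : Circle.exp θ ∈ V) :
    ∃ a, L.lift θ a ∧ ∀ t, θ < t → t < θ + 2 * π → Circle.exp t ∈ V → a ≤ t := by
  classical
  choose τ h1 h2 h3 using exists_angle θ
  obtain ⟨v, hv, hmin⟩ := (V.erase (Circle.exp θ)).exists_min_image τ
    (Finset.card_pos.1 (by rw [Finset.card_erase_of_mem hθ]; omega))
  rw [Finset.mem_erase] at hv
  have hlt : ∀ w : Circle, w ≠ Circle.exp θ → θ < τ w := fun w hw =>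
    lt_of_le_of_ne (h1 w) fun h => hw (by rw [h, h3])
  have hle : ∀ t, θ < t → t < θ + 2 * π → Circle.exp t ∈ V → τ v ≤ t := by
    intro t ht1 ht2 ht
    have := hmin (Circle.exp t) (Finset.mem_erase.2 ⟨(exp_ne_exp ht1 ht2).symm, ht⟩)
    rwa [Circle.exp_injOn_Ico (a := θ) (b := θ + 2 * π) (by linarith) ⟨h1 _, h2 _⟩ ⟨ht1.le, ht2⟩
      (h3 _)] at this
  refine ⟨τ v, ?_, hle⟩
  have hsub := subset_convexHull ℝ ((fun v : Circle => (v : ℂ)) '' (V : Set Circle))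
  have hmem : ∀ w ∈ V, (w : ℂ) ∈ closure (L.region z₀) := by
    intro w hw
    rw [hP]
    exact hsub (mem_image_of_mem _ hw)
  refine edge_mem (z₀ := z₀) (hlt v hv.1) (h2 v) ?_ (hmem _ hθ) (by rw [h3]; exact hmem _ hv.2) ?_
  · rw [hP]; exact convex_convexHull ℝ _
  · rw [hP]
    refine fun z hz => convexHull_min ?_ (convex_level_nonpos θ (τ v)) hz
    rintro _ ⟨w, hw, rfl⟩
    change level θ (τ v) w ≤ 0
    by_cases hwθ : w = Circle.exp θ
    · rw [hwθ, level_left]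
    · have h4 := hmin w (Finset.mem_erase.2 ⟨hwθ, hw⟩)
      rcases h4.eq_or_lt with h5 | h5
      · rw [← h3 w, ← h5, level_right]
      · rw [← h3 w]
        exact (level_neg (hlt v hv.1) h5 (h2 w)).le

end Lamination

namespace Lamination

variable {L : Lamination}

/-- Two edges of a gap cannot be separated by a third leaf, so by looseness at most two leaves
share an endpoint. -/
theorem lift_three (hL : L.IsLoose) {x a b c : ℝ} (ha : L.lift x a) (hb : L.lift x b)
    (hc : L.lift x c) (hab : a < b) (hbc : b < c) : False := by
  have hne : s(Circle.exp x, Circle.exp a) ≠ s(Circle.exp x, Circle.exp c) := by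
    intro h
    rw [Sym2.congr_right] at h
    exact exp_ne_exp (hab.trans hbc) (by linarith [ha.1, hc.2.1]) h
  obtain ⟨P, ⟨z₀, -, hP⟩, ⟨-, he1⟩, -, he2⟩ := hL _ ha.2.2 _ hc.2.2 hne
    ⟨Circle.exp x, Sym2.mem_mk_left _ _, Sym2.mem_mk_left _ _⟩
  have hfr : frontier P ⊆ P := by
    rw [hP]
    exact isClosed_closure.frontier_subset
  have h1 := hfr (he1 (right_mem_segment ℝ (Circle.exp x : ℂ) (Circle.exp a)))
  have h2 := hfr (he2 (right_mem_segment ℝ (Circle.exp x : ℂ) (Circle.exp c)))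
  have h3 := level_pos ha.1 hab hb.2.1
  have h4 := level_neg hb.1 hbc hc.2.1
  rw [hP] at h1 h2
  rcases gap_side hb z₀ with h | h
  · exact absurd h4 (not_lt.2 (h _ h2))
  · exact absurd h3 (not_lt.2 (h _ h1))

/-- The open arc of angles at distance less than `ε` from `θ`. -/
def arc (θ ε : ℝ) : Set Circle := Circle.exp '' Ioo (θ - ε) (θ + ε)

theorem isOpen_exp_image {s : Set ℝ} (hs : IsOpen s) : IsOpen (Circle.exp '' s) :=
  isLocalHomeomorph_circleExp.isOpenMap _ hs

theorem mem_arc_self {θ ε : ℝ} (hε : 0 < ε) : Circle.exp θ ∈ arc θ ε :=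
  ⟨θ, ⟨by linarith, by linarith⟩, rfl⟩

/-- Along a curve `γ` in the disk, ending at `γ 0`, either there are leaves or the curve stays in
one gap, which contains its end. -/
theorem exists_support_or_mem_gap {γ : ℝ → ℂ} (hγ : Continuous γ)
    {r : ℝ} (hr : 0 < r) (hnorm : ∀ s, 0 < s → s < r → ‖γ s‖ < 1) :
    (∃ s, 0 < s ∧ s < r ∧ γ s ∈ L.support) ∨
      ∃ z₀ ∈ Metric.ball (0 : ℂ) 1 \ L.support, (∀ s, 0 < s → s < r → γ s ∈ L.region z₀) ∧
        γ 0 ∈ closure (L.region z₀) := by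
  by_contra! hcon
  obtain ⟨h1, h2⟩ := hcon
  have hO : ∀ s, 0 < s → s < r → γ s ∈ Metric.ball (0 : ℂ) 1 \ L.support := fun s hs hs' =>
    ⟨mem_ball_zero_iff.2 (hnorm s hs hs'), h1 s hs hs'⟩
  have hin : ∀ s, 0 < s → s < r → γ s ∈ L.region (γ (r / 2)) := by
    intro s hs hs'
    refine (isPreconnected_Ioo.image γ hγ.continuousOn).subset_connectedComponentIn
      (s := γ '' Ioo 0 r) (mem_image_of_mem _ ⟨by linarith, by linarith⟩) ?_
      (mem_image_of_mem _ ⟨hs, hs'⟩)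
    rintro _ ⟨t, ht, rfl⟩
    exact hO t ht.1 ht.2
  refine h2 _ (hO (r / 2) (by linarith) (by linarith)) hin ?_
  have h0 : (0 : ℝ) ∈ closure (Ioo 0 r) := by
    rw [closure_Ioo hr.ne]; exact ⟨le_rfl, hr.le⟩
  refine closure_mono ?_ (image_closure_subset_closure_image hγ (mem_image_of_mem _ h0))
  rintro _ ⟨t, ht, rfl⟩
  exact hin t ht.1 ht.2

/-- A point that is not an endpoint is a nested intersection of arcs cut off by leaves: otherwise it
would be a vertex of the gap in which the radius to it ends. -/
theorem lift_rainbow (hL : L.IsVeryFull) {θ : ℝ} (hend : ∀ b, ¬ L.lift θ b) {ε : ℝ} (hε : 0 < ε) :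
    ∃ a b, L.lift a b ∧ θ - ε < a ∧ a < θ ∧ θ < b ∧ b < θ + ε := by
  set ε' := min ε (π / 2) with hε'
  have hε0 : 0 < ε' := lt_min hε (by positivity)
  have h1 : ε' ≤ ε := min_le_left _ _
  have h2 : ε' ≤ π / 2 := min_le_right _ _
  have hN : IsOpen (arc θ ε') := isOpen_exp_image isOpen_Ioo
  have hD : IsClosed (L.pairs ∩ (arc θ ε' ×ˢ arc θ ε')ᶜ) :=
    isClosed_pairs.inter (hN.prod hN).isClosed_compl
  have hend' : ∀ y, s(Circle.exp θ, y) ∉ L.leaves := fun y hy => by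
    obtain ⟨b, hb, -⟩ := exists_lift hy θ rfl
    exact hend b hb
  have hout : (Circle.exp θ : ℂ) ∉ hull (L.pairs ∩ (arc θ ε' ×ˢ arc θ ε')ᶜ) := by
    classical
    rintro ⟨⟨x, y⟩, ⟨h3, h4⟩, h5⟩
    have h6 : Circle.exp θ ∈ ({x, y} : Finset Circle) := by
      apply mem_of_mem_convexHull
      simpa [image_pair, convexHull_pair] using h5
    rw [Finset.mem_insert, Finset.mem_singleton] at h6
    rcases h3 with h3 | h3
    · rcases h6 with h6 | h6
      · exact hend' y (h6 ▸ h3)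
      · exact hend' x (by rw [h6, Sym2.eq_swap]; exact h3)
    · have h3 : x = y := h3
      have hx : x = Circle.exp θ := by
        rcases h6 with h6 | h6
        · exact h6.symm
        · exact h3.trans h6.symm
      exact h4 ⟨hx ▸ mem_arc_self hε0, h3 ▸ hx ▸ mem_arc_self hε0⟩
  have hγ : Continuous fun s : ℝ => (1 - s) • (Circle.exp θ : ℂ) := by fun_prop
  obtain ⟨r, hr, hball⟩ := Metric.mem_nhds_iff.1
    (((isClosed_hull hD).isOpen_compl.preimage hγ).mem_nhds
    (show (0 : ℝ) ∈ _ by simpa using hout))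
  have hnorm : ∀ s, 0 < s → s < min r 1 → ‖(1 - s) • (Circle.exp θ : ℂ)‖ < 1 := by
    intro s hs hs'
    have := hs'.trans_le (min_le_right _ _)
    rw [norm_smul, Circle.norm_coe, mul_one, Real.norm_eq_abs, abs_lt]
    constructor <;> linarith
  rcases exists_support_or_mem_gap (L := L) hγ (lt_min hr one_pos) hnorm with
    ⟨s, hs, hsr, hsup⟩ | ⟨z₀, hz₀, -, hmem⟩
  · obtain ⟨x, y, hxy, hseg⟩ := mem_support.1 hsup
    have hs1 := hsr.trans_le (min_le_right _ _)
    have hin : (x, y) ∈ arc θ ε' ×ˢ arc θ ε' := by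
      by_contra hnot
      refine hball (a := s) ?_ ⟨(x, y), ⟨Or.inl hxy, hnot⟩, hseg⟩
      rw [Metric.mem_ball, Real.dist_eq, sub_zero, abs_of_pos hs]
      exact hsr.trans_le (min_le_left _ _)
    obtain ⟨⟨a, ha, rfl⟩, ⟨b, hb, rfl⟩⟩ := hin
    -- the radius to `θ` meets the chord, so `θ` separates `a` from `b`
    have key : ∀ a b : ℝ, a ∈ Ioo (θ - ε') (θ + ε') → b ∈ Ioo (θ - ε') (θ + ε') → a < b →
        s(Circle.exp a, Circle.exp b) ∈ L.leaves →
        (1 - s) • (Circle.exp θ : ℂ) ∈ segment ℝ (Circle.exp a : ℂ) (Circle.exp b) →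
        ∃ a b, L.lift a b ∧ θ - ε < a ∧ a < θ ∧ θ < b ∧ b < θ + ε := by
      intro a b ha hb hab hl hseg
      obtain ⟨α, β, hα, hβ, hαβ, hz⟩ := hseg
      have hre := congrArg Complex.re hz
      have him := congrArg Complex.im hz
      simp only [Complex.add_re, Complex.add_im, Complex.real_smul, Complex.re_ofReal_mul,
        Complex.im_ofReal_mul, exp_re, exp_im] at hre him
      have h0 : α * sin (a - θ) + β * sin (b - θ) = 0 := by
        rw [sin_sub, sin_sub]
        linear_combination cos θ * him - sin θ * hre
      have haθ : a ≠ θ := by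
        rintro rfl
        exact hend' _ hl
      have hbθ : b ≠ θ := by
        rintro rfl
        exact hend' _ (by rw [Sym2.eq_swap]; exact hl)
      have h3 := ha.1
      have h4 := hb.2
      refine ⟨a, b, ⟨hab, by linarith [pi_pos], hl⟩, by linarith, ?_, ?_, by linarith⟩
      · by_contra! hle
        have h5 := lt_of_le_of_ne hle haθ.symm
        have := sin_pos_of_pos_of_lt_pi (x := a - θ) (by linarith) (by linarith)
        have := sin_pos_of_pos_of_lt_pi (x := b - θ) (by linarith) (by linarith)
        rcases hα.eq_or_lt with rfl | hα
        · have : β = 1 := by linarith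
          subst this; linarith
        · have : 0 < α * sin (a - θ) := by positivity
          have : 0 ≤ β * sin (b - θ) := by positivity
          linarith
      · by_contra! hle
        have h5 := lt_of_le_of_ne hle hbθ
        have := sin_neg_of_neg_of_neg_pi_lt (x := a - θ) (by linarith) (by linarith)
        have := sin_neg_of_neg_of_neg_pi_lt (x := b - θ) (by linarith) (by linarith)
        rcases hα.eq_or_lt with rfl | hα
        · have : β = 1 := by linarith
          subst this; linarith
        · nlinarith
    rcases lt_trichotomy a b with hab | rfl | hab
    · exact key a b ha hb hab hxy hseg
    · exact absurd rfl (ne_of_leaf hxy)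
    · exact key b a hb ha hab (by rw [Sym2.eq_swap]; exact hxy) (by rwa [segment_symm])
  · obtain ⟨V, hV, hP⟩ := hL _ ⟨z₀, hz₀, rfl⟩
    rw [sub_zero, one_smul, hP] at hmem
    obtain ⟨a, ha, -⟩ := exists_edge hV hP (mem_of_mem_convexHull hmem)
    exact absurd ha (hend a)

/-- If the midpoint of a chord is in the convex hull of circle points on one side of it, then the
first endpoint is among those points. -/
theorem mem_of_midpt_mem {p q : ℝ} (h1 : p < q) (h2 : q < p + 2 * π) {V : Finset Circle}
    (hV : ∀ v ∈ V, 0 ≤ level p q v)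
    (hm : midpt p q ∈ convexHull ℝ ((fun v : Circle => (v : ℂ)) '' (V : Set Circle))) :
    Circle.exp p ∈ V := by
  by_contra hp
  -- an open half plane together with one boundary point is convex
  have hconv : Convex ℝ {z : ℂ | 0 < level p q z ∨ z = Circle.exp q} := by
    refine convex_iff_forall_pos.2 fun x hx y hy a b ha hb hab => ?_
    have hnn : ∀ z : ℂ, 0 < level p q z ∨ z = Circle.exp q → 0 ≤ level p q z := by
      rintro z (hz | rfl)
      · exact hz.le
      · rw [level_right]
    have hx0 := hnn x hx
    have hy0 := hnn y hy
    rcases hx with hx | rfl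
    · left
      rw [level_comb p q hab]
      positivity
    · rcases hy with hy | rfl
      · left
        rw [level_comb p q hab]
        positivity
      · right
        rw [← add_smul, hab, one_smul]
  have hsub : (fun v : Circle => (v : ℂ)) '' (V : Set Circle) ⊆
      {z : ℂ | 0 < level p q z ∨ z = Circle.exp q} := by
    rintro _ ⟨v, hv, rfl⟩
    rcases (hV v hv).eq_or_lt with h | h
    · rcases eq_of_level h1 h2 v h.symm with rfl | rfl
      · exact absurd hv hp
      · exact Or.inr rfl
    · exact Or.inl h
  rcases convexHull_min hsub hconv hm with h | h
  · rw [level_midpt] at h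
    exact lt_irrefl _ h
  · have := norm_midpt h1 h2
    rw [h, Circle.norm_coe] at this
    exact lt_irrefl _ this

/-- On each side of a leaf there is a gap, which has a further edge at an endpoint of the leaf, or
leaves accumulate. -/
theorem lift_side (hL : L.IsVeryFull) {p q : ℝ} (h : L.lift p q) :
    (∃ v, p < v ∧ v < q ∧ (L.lift p v ∨ L.lift v q)) ∨
    ∀ ε > 0, ∃ c d, L.lift c d ∧ p < c ∧ c < p + ε ∧ q - ε < d ∧ d < q := by
  by_contra! hcon
  obtain ⟨hcon, ε, hε, hacc⟩ := hcon
  obtain ⟨h1, h2, hl⟩ := id h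
  set ε' := min ε (min ((q - p) / 2) ((p + 2 * π - q) / 2)) with hε'
  have hε0 : 0 < ε' := lt_min hε (lt_min (by linarith) (by linarith))
  have e1 : ε' ≤ ε := min_le_left _ _
  have e2 : ε' ≤ (q - p) / 2 := (min_le_right _ _).trans (min_le_left _ _)
  have e3 : ε' ≤ (p + 2 * π - q) / 2 := (min_le_right _ _).trans (min_le_right _ _)
  have hNp : IsOpen (arc p ε') := isOpen_exp_image isOpen_Ioo
  have hNq : IsOpen (arc q ε') := isOpen_exp_image isOpen_Ioo
  set W := arc p ε' ×ˢ arc q ε' ∪ arc q ε' ×ˢ arc p ε' with hW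
  have hD : IsClosed (L.pairs ∩ Wᶜ) :=
    isClosed_pairs.inter ((hNp.prod hNq).union (hNq.prod hNp)).isClosed_compl
  have hm := norm_midpt h1 h2
  have hout : midpt p q ∉ hull (L.pairs ∩ Wᶜ) := by
    rintro ⟨⟨x, y⟩, ⟨h3 | h3, h4⟩, h5⟩
    · have h6 := eq_of_meet h h3 hm (level_midpt p q) h5
      rcases Sym2.eq_iff.1 h6 with ⟨h7, h8⟩ | ⟨h7, h8⟩
      · exact h4 (Or.inl ⟨h7 ▸ mem_arc_self hε0, h8 ▸ mem_arc_self hε0⟩)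
      · exact h4 (Or.inr ⟨h7 ▸ mem_arc_self hε0, h8 ▸ mem_arc_self hε0⟩)
    · exact norm_lt_one_of_segment h3 h5 hm
  have hγ := continuous_offset p q
  obtain ⟨r, hr, hball⟩ := Metric.mem_nhds_iff.1
    (((isClosed_hull hD).isOpen_compl.preimage hγ).mem_nhds
    (show (0 : ℝ) ∈ _ by rw [mem_preimage, offset_zero]; exact hout))
  obtain ⟨r', hr', hball'⟩ := Metric.mem_nhds_iff.1 ((Metric.isOpen_ball.preimage hγ).mem_nhds
    (show (0 : ℝ) ∈ _ ⁻¹' Metric.ball (0 : ℂ) 1 by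
      rw [mem_preimage, offset_zero, mem_ball_zero_iff]; exact hm))
  have hnorm : ∀ s, 0 < s → s < min r r' → ‖offset p q s‖ < 1 := by
    intro s hs hs'
    refine mem_ball_zero_iff.1 (hball' (a := s) ?_)
    rw [Metric.mem_ball, Real.dist_eq, sub_zero, abs_of_pos hs]
    exact hs'.trans_le (min_le_right _ _)
  rcases exists_support_or_mem_gap (L := L) hγ (lt_min hr hr') hnorm with
    ⟨s, hs, hsr, hsup⟩ | ⟨z₀, hz₀, hin, hmem⟩
  · obtain ⟨x, y, hxy, hseg⟩ := mem_support.1 hsup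
    have hin : (x, y) ∈ W := by
      by_contra hnot
      refine hball (a := s) ?_ ⟨(x, y), ⟨Or.inl hxy, hnot⟩, hseg⟩
      rw [Metric.mem_ball, Real.dist_eq, sub_zero, abs_of_pos hs]
      exact hsr.trans_le (min_le_left _ _)
    -- the leaf through the chosen point has endpoints near `p` and `q`, on the side of `s > 0`
    have key : ∀ c d : ℝ, c ∈ Ioo (p - ε') (p + ε') → d ∈ Ioo (q - ε') (q + ε') →
        s(Circle.exp c, Circle.exp d) ∈ L.leaves →
        offset p q s ∈ segment ℝ (Circle.exp c : ℂ) (Circle.exp d) → False := by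
      rintro c d ⟨hc1, hc2⟩ ⟨hd1, hd2⟩ hl' ⟨α, β, hα, hβ, hαβ, hz⟩
      have hs0 := level_offset p q s
      rw [← hz, level_comb p q hαβ] at hs0
      have hcd : L.lift c d := ⟨by linarith, by linarith, hl'⟩
      rcases lt_trichotomy d q with hd | rfl | hd
      · rcases lt_trichotomy c p with hc | rfl | hc
        · exact lift_unlinked hcd h hc (by linarith) hd (by linarith)
        · exact (hcon d (by linarith) hd).1 hcd
        · exact absurd hd (not_lt.2 (hacc c d hcd hc (by linarith) (by linarith)))
      · rcases lt_trichotomy c p with hc | rfl | hc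
        · have := level_neg (t := c + 2 * π) h1 (by linarith) (by linarith)
          rw [Circle.exp_add_two_pi] at this
          rw [level_right] at hs0
          nlinarith
        · rw [level_left, level_right] at hs0
          linarith
        · exact (hcon c hc (by linarith)).2 hcd
      · have hd0 := level_neg (t := d) h1 hd (by linarith)
        rcases lt_trichotomy c p with hc | rfl | hc
        · have := level_neg (t := c + 2 * π) h1 (by linarith) (by linarith)
          rw [Circle.exp_add_two_pi] at this
          nlinarith
        · rw [level_left] at hs0
          nlinarith
        · exact lift_unlinked h hcd hc (by linarith) hd (by linarith)
    rcases hin with ⟨⟨c, hc, rfl⟩, ⟨d, hd, rfl⟩⟩ | ⟨⟨c, hc, rfl⟩, ⟨d, hd, rfl⟩⟩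
    · exact key c d hc hd hxy hseg
    · exact key d c hd hc (by rw [Sym2.eq_swap]; exact hxy) (by rwa [segment_symm])
  · obtain ⟨V, hV, hP⟩ := hL _ ⟨z₀, hz₀, rfl⟩
    have hsub := subset_convexHull ℝ ((fun v : Circle => (v : ℂ)) '' (V : Set Circle))
    have hside : ∀ v ∈ V, 0 ≤ level p q v := by
      rcases gap_side h z₀ with hs | hs
      · intro v hv
        exact hs _ (by rw [hP]; exact hsub (mem_image_of_mem _ hv))
      · have hpos : 0 < min r r' := lt_min hr hr'
        have := hs _ (subset_closure (hin (min r r' / 2) (by linarith) (by linarith)))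
        rw [level_offset] at this
        linarith
    rw [offset_zero, hP] at hmem
    have hp := mem_of_midpt_mem h1 h2 hside hmem
    obtain ⟨a, ha, hmin⟩ := exists_edge hV hP hp
    classical
    obtain ⟨v, hv, hv'⟩ := Finset.exists_mem_notMem_of_card_lt_card
      (s := {Circle.exp p, Circle.exp q}) (t := V) (lt_of_le_of_lt Finset.card_le_two hV)
    rw [Finset.mem_insert, Finset.mem_singleton] at hv'
    have hv0 : 0 < level p q v :=
      lt_of_le_of_ne (hside v hv) fun h0 => hv' (eq_of_level h1 h2 v h0.symm)
    obtain ⟨t, ht1, ht2, rfl⟩ := exists_of_level_pos h1 v hv0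
    exact (hcon a ha.1 ((hmin t ht1 (by linarith) hv).trans_lt ht2)).1 ha

/-- The lift of a very full loose lamination to the universal cover. -/
theorem lineLam (hfull : L.IsVeryFull) (hloose : L.IsLoose) : LineLam (2 * π) L.lift where
  pos := two_pi_pos
  lt h := h.1
  lt_add h := h.2.1
  swap := lift_swap
  unlinked := lift_unlinked
  closed {u v a b} h hu hv hab hba := by
    refine ⟨hab, hba, ?_⟩
    have h1 : (Circle.exp a, Circle.exp b) ∈ L.pairs := by
      refine isClosed_pairs.mem_of_tendsto (f := fun n => (Circle.exp (u n), Circle.exp (v n)))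
        (b := atTop) ?_ (Eventually.of_forall fun n => Or.inl (h n).2.2)
      exact ((Circle.exp.continuous.tendsto a).comp hu).prodMk_nhds
        ((Circle.exp.continuous.tendsto b).comp hv)
    exact h1.resolve_right (exp_ne_exp hab hba)
  three := lift_three hloose
  rainbow hend ε hε := lift_rainbow hfull hend hε
  side := lift_side hfull

end Lamination

/-! ### Lifts of circle homeomorphisms and point stabilizers -/

/-- `F` is a lift of the circle homeomorphism `g` to the universal cover. -/
structure IsLift (F : ℝ ≃o ℝ) (g : Circle ≃ₜ Circle) : Prop where
  shift : ∀ t, F (t + 2 * π) = F t + 2 * π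
  map_exp : ∀ t, g (Circle.exp t) = Circle.exp (F t)

theorem OrientationPreserving.exists_lift {g : Circle ≃ₜ Circle} (hg : OrientationPreserving g) :
    ∃ F, IsLift F g := by
  obtain ⟨F, hc, hm, hF⟩ := hg
  have hπ := two_pi_pos
  have hshift : ∀ t, F (t + 2 * π) = F t + 2 * π := by
    intro t
    have h1 : Circle.exp (F (t + 2 * π)) = Circle.exp (F t) := by
      rw [← hF, ← hF, Circle.exp_add_two_pi]
    obtain ⟨n, hn⟩ := Circle.exp_eq_exp.1 h1
    have h2 : F t < F (t + 2 * π) := hm (by linarith)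
    -- the degree `n` is positive by monotonicity, and at most one by injectivity
    have hn0 : 0 < n := by
      have h3 : 0 < (n : ℝ) * (2 * π) := by linarith
      exact_mod_cast pos_of_mul_pos_left h3 hπ.le
    by_contra hne
    have hn2 : 2 ≤ n := by
      by_contra! h3
      have : n = 1 := by omega
      subst this
      exact hne (by rw [hn]; push_cast; ring)
    have hn2' : (2 : ℝ) ≤ n := by exact_mod_cast hn2
    obtain ⟨s, ⟨hs1, hs2⟩, hs⟩ := intermediate_value_Icc (by linarith : t ≤ t + 2 * π)
      hc.continuousOn (show F t + 2 * π ∈ Icc (F t) (F (t + 2 * π)) from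
        ⟨by linarith, by rw [hn]; nlinarith⟩)
    have hs1' : t < s := lt_of_le_of_ne hs1 (by rintro rfl; linarith)
    have hs2' : s < t + 2 * π := lt_of_le_of_ne hs2 (by rintro rfl; exact hne hs)
    refine exp_ne_exp hs1' hs2' (g.injective ?_)
    rw [hF, hF, hs, Circle.exp_add_two_pi]
  have hn : ∀ (n : ℕ), F (n * (2 * π)) = F 0 + n * (2 * π) := by
    intro n
    induction n with
    | zero => simp
    | succ n ih =>
      have := hshift (n * (2 * π))
      push_cast
      rw [add_mul, one_mul, this, ih]; ring
  have hn' : ∀ (n : ℕ), F (-(n * (2 * π))) = F 0 - n * (2 * π) := by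
    intro n
    induction n with
    | zero => simp
    | succ n ih =>
      have := hshift (-((n + 1 : ℕ) * (2 * π)))
      rw [show -((n + 1 : ℕ) * (2 * π)) + 2 * π = -(n * (2 * π)) by push_cast; ring, ih] at this
      push_cast at this ⊢
      linarith
  have hsurj : Function.Surjective F := by
    intro y
    obtain ⟨n, hn0⟩ := exists_nat_gt ((y - F 0) / (2 * π))
    obtain ⟨m, hm0⟩ := exists_nat_gt ((F 0 - y) / (2 * π))
    rw [div_lt_iff₀ hπ] at hn0 hm0
    have h1 : -(m * (2 * π)) ≤ n * (2 * π) := by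
      have : (0 : ℝ) ≤ m * (2 * π) := by positivity
      have : (0 : ℝ) ≤ n * (2 * π) := by positivity
      linarith
    obtain ⟨s, -, hs⟩ := intermediate_value_Icc h1 hc.continuousOn
      (show y ∈ Icc _ _ from ⟨by rw [hn']; linarith, by rw [hn]; linarith⟩)
    exact ⟨s, hs⟩
  exact ⟨hm.orderIsoOfSurjective F hsurj, hshift, hF⟩

/-- A homeomorphism that fixes a point has a lift that fixes a given angle of it. -/
theorem OrientationPreserving.exists_lift_fixed {g : Circle ≃ₜ Circle}
    (hg : OrientationPreserving g) {θ : ℝ} (hθ : g (Circle.exp θ) = Circle.exp θ) :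
    ∃ F, IsLift F g ∧ F θ = θ := by
  obtain ⟨F, hF⟩ := hg.exists_lift
  have h1 : Circle.exp (F θ) = Circle.exp θ := by rw [← hF.map_exp, hθ]
  obtain ⟨n, hn⟩ := Circle.exp_eq_exp.1 h1
  have hval : ∀ t, (F.trans (OrderIso.addRight (-(n * (2 * π))))) t = F t + -(n * (2 * π)) :=
    fun t => rfl
  refine ⟨F.trans (OrderIso.addRight (-(n * (2 * π)))), ⟨fun t => ?_, fun t => ?_⟩, ?_⟩
  · rw [hval, hval, hF.shift]; ring
  · rw [hval, hF.map_exp, Circle.exp_eq_exp]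
    exact ⟨n, by ring⟩
  · rw [hval, hn]; ring

theorem IsLift.mul {F F' : ℝ ≃o ℝ} {g g' : Circle ≃ₜ Circle} (h : IsLift F g)
    (h' : IsLift F' g') : IsLift (F * F') (g * g') := by
  refine ⟨fun t => ?_, fun t => ?_⟩
  · rw [RelIso.mul_apply, RelIso.mul_apply, h'.shift, h.shift]
  · rw [RelIso.mul_apply, Homeomorph.mul_apply, h'.map_exp, h.map_exp]

theorem IsLift.inv {F : ℝ ≃o ℝ} {g : Circle ≃ₜ Circle} (h : IsLift F g) :
    IsLift F⁻¹ g⁻¹ := by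
  have hcancel : ∀ t, F (F⁻¹ t) = t := fun t => by
    rw [← RelIso.mul_apply, mul_inv_cancel, RelIso.one_apply]
  refine ⟨fun t => F.injective ?_, fun t => g.injective ?_⟩
  · rw [h.shift, hcancel, hcancel]
  · rw [← Homeomorph.mul_apply, mul_inv_cancel, Homeomorph.one_apply, h.map_exp, hcancel]

theorem IsLift.one : IsLift 1 1 := ⟨fun _ => rfl, fun _ => rfl⟩

theorem IsLift.ext {F : ℝ ≃o ℝ} {g g' : Circle ≃ₜ Circle} (h : IsLift F g) (h' : IsLift F g') :
    g = g' := by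
  ext x
  obtain ⟨t, rfl⟩ := Circle.exp_surjective x
  rw [h.map_exp, h'.map_exp]

theorem IsLift.preserves {F : ℝ ≃o ℝ} {g : Circle ≃ₜ Circle} (h : IsLift F g) {L : Lamination}
    {G : Subgroup (Circle ≃ₜ Circle)} (hL : L.IsInvariant G) (hg : g ∈ G) :
    Preserves (2 * π) L.lift F := by
  refine ⟨h.shift, fun {a b} => ?_⟩
  unfold Lamination.lift
  rw [F.lt_iff_lt, ← h.shift, F.lt_iff_lt, ← h.map_exp, ← h.map_exp, ← Sym2.map_mk]
  have : Sym2.map g s(Circle.exp a, Circle.exp b) ∈ L.leaves ↔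
      s(Circle.exp a, Circle.exp b) ∈ L.leaves := by
    conv_lhs => rw [← hL g hg]
    exact (Sym2.map.injective g.injective).mem_set_image
  rw [this]

/-- A lift of the identity with a fixed point is the identity. -/
theorem IsLift.eq_one {F : ℝ ≃o ℝ} (h : IsLift F 1) {θ : ℝ} (hθ : F θ = θ) : F = 1 := by
  have hP : Preserves (2 * π) (fun _ _ => True) F := ⟨h.shift, Iff.rfl⟩
  ext t
  rw [RelIso.one_apply]
  obtain ⟨n, ⟨h1, h2⟩, -⟩ := existsUnique_add_zsmul_mem_Ico two_pi_pos t θ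
  rw [← hP.fixed_zsmul n]
  set s := t + n • (2 * π)
  have h3 := F.monotone h1
  have h4 := F.strictMono h2
  rw [hθ] at h3
  rw [h.shift, hθ] at h4
  exact Circle.exp_injOn_Ico (a := θ) (b := θ + 2 * π) (by linarith) ⟨h3, h4⟩ ⟨h1, h2⟩
    (h.map_exp s).symm

theorem countable_exp_preimage {S : Set Circle} (hS : S.Countable) :
    (Circle.exp ⁻¹' S).Countable := by
  have : Circle.exp ⁻¹' S = ⋃ x ∈ S, Circle.exp ⁻¹' {x} := by
    ext t; simp
  rw [this]
  refine hS.biUnion fun x _ => ?_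
  obtain ⟨t, rfl⟩ := Circle.exp_surjective x
  refine (countable_range fun n : ℤ => t + n * (2 * π)).mono fun s hs => ?_
  obtain ⟨n, hn⟩ := Circle.exp_eq_exp.1 (mem_singleton_iff.1 hs)
  exact ⟨n, hn.symm⟩

theorem transverse_lift {L₁ L₂ : Lamination} (h1 : L₁.IsVeryFull ∧ L₁.IsLoose)
    (h2 : L₂.IsVeryFull ∧ L₂.IsLoose) (hd : Disjoint L₁.ends L₂.ends) :
    Transverse (2 * π) L₁.lift L₂.lift where
  fst := Lamination.lineLam h1.1 h1.2
  snd := Lamination.lineLam h2.1 h2.2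
  disjoint h h' := hd.notMem_of_mem_left ⟨_, h.2.2, Sym2.mem_mk_left _ _⟩
    ⟨_, h'.2.2, Sym2.mem_mk_left _ _⟩

theorem commute_of_not_end {G : Subgroup (Circle ≃ₜ Circle)}
    (hor : ∀ g ∈ G, OrientationPreserving g) {L₁ L₂ : Lamination}
    (hT : Transverse (2 * π) L₁.lift L₂.lift) (h1 : L₁.IsInvariant G) (h2 : L₂.IsInvariant G)
    (hc : ∀ g ∈ G, g ≠ 1 → {x : Circle | g x = x}.Countable) {θ : ℝ}
    (hend : ∀ b, ¬ L₁.lift θ b) {g h : Circle ≃ₜ Circle} (hg : g ∈ G) (hh : h ∈ G)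
    (hgθ : g (Circle.exp θ) = Circle.exp θ) (hhθ : h (Circle.exp θ) = Circle.exp θ) :
    g * h = h * g := by
  let Γ : Subgroup (ℝ ≃o ℝ) :=
    { carrier := {F | F θ = θ ∧ ∃ g ∈ G, IsLift F g}
      mul_mem' := by
        rintro F F' ⟨h1, g, hg, hF⟩ ⟨h2, g', hg', hF'⟩
        exact ⟨by rw [RelIso.mul_apply, h2, h1], g * g', G.mul_mem hg hg', hF.mul hF'⟩
      one_mem' := ⟨rfl, 1, G.one_mem, IsLift.one⟩
      inv_mem' := by
        rintro F ⟨h1, g, hg, hF⟩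
        exact ⟨inv_fixed.2 h1, g⁻¹, G.inv_mem hg, hF.inv⟩ }
  obtain ⟨F, hF, hFθ⟩ := (hor g hg).exists_lift_fixed hgθ
  obtain ⟨F', hF', hFθ'⟩ := (hor h hh).exists_lift_fixed hhθ
  have hcomm := commute_of_fixed hT Γ
    (fun F ⟨_, g, hg, hF⟩ => hF.preserves h1 hg) (fun F ⟨_, g, hg, hF⟩ => hF.preserves h2 hg)
    (fun F hF => hF.1) hend ?_ F ⟨hFθ, g, hg, hF⟩ F' ⟨hFθ', h, hh, hF'⟩
  · have := hF'.mul hF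
    rw [← hcomm] at this
    exact (hF.mul hF').ext this
  · rintro F ⟨hFθ, g, hg, hF⟩ hne
    have hg1 : g ≠ 1 := by
      rintro rfl
      exact hne (hF.eq_one hFθ)
    refine (countable_exp_preimage (hc g hg hg1)).mono fun t (ht : F t = t) => ?_
    change g (Circle.exp t) = Circle.exp t
    rw [hF.map_exp, ht]

/-- Stabilizers of points in a pseudo-fibered group are abelian. -/
theorem IsPseudoFibered.commute_of_fixed {G : Subgroup (Circle ≃ₜ Circle)}
    (hG : IsPseudoFibered G) {x : Circle} {g h : Circle ≃ₜ Circle} (hg : g ∈ G) (hh : h ∈ G)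
    (hgx : g x = x) (hhx : h x = x) : g * h = h * g := by
  obtain ⟨-, ⟨hor, -, -⟩, ⟨L₁, L₂, ⟨hf1, hl1, hi1⟩, ⟨hf2, hl2, hi2⟩, hd⟩, hc⟩ := hG
  have hT := transverse_lift ⟨hf1, hl1⟩ ⟨hf2, hl2⟩ hd
  obtain ⟨θ, rfl⟩ := Circle.exp_surjective x
  by_cases hend : ∀ b, ¬ L₁.lift θ b
  · exact commute_of_not_end hor hT hi1 hi2 hc hend hg hh hgx hhx
  · push Not at hend
    obtain ⟨b, hb⟩ := hend
    exact commute_of_not_end hor hT.symm hi2 hi1 hc (fun c hc => hT.disjoint hb hc) hg hh hgx hhx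

/-! ### Minimal sets and ping-pong -/

noncomputable instance : MulAction (Circle ≃ₜ Circle) Circle where
  smul g x := g x
  one_smul _ := rfl
  mul_smul _ _ _ := rfl

variable {H : Subgroup (Circle ≃ₜ Circle)}

/-- A closed nonempty `H`-invariant subset of the circle. -/
structure ClosedInvariant (H : Subgroup (Circle ≃ₜ Circle)) (K : Set Circle) : Prop where
  isClosed : IsClosed K
  nonempty : K.Nonempty
  map_mem : ∀ g ∈ H, ∀ x ∈ K, g x ∈ K

variable (H) in
theorem exists_minimal_closedInvariant : ∃ K, Minimal (ClosedInvariant H) K := by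
  obtain ⟨K, -, hK⟩ := zorn_superset_nonempty {K | ClosedInvariant H K} (fun c hc hchain hne => by
    have : Nonempty c := hne.to_subtype
    refine ⟨⋂₀ c, ⟨isClosed_sInter fun K hK => (hc hK).isClosed, ?_, fun g hg x hx K hK =>
      (hc hK).map_mem g hg x (hx K hK)⟩, fun K hK => sInter_subset_of_mem hK⟩
    exact IsCompact.nonempty_sInter_of_directed_nonempty_isCompact_isClosed
      (fun K hK K' hK' => (hchain.total hK hK').elim (fun h => ⟨K, hK, Subset.rfl, h⟩)
        fun h => ⟨K', hK', h, Subset.rfl⟩)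
      (fun K hK => (hc hK).nonempty) (fun K hK => (hc hK).isClosed.isCompact)
      fun K hK => (hc hK).isClosed) univ
    ⟨isClosed_univ, univ_nonempty, fun _ _ _ _ => mem_univ _⟩
  exact ⟨K, hK⟩

theorem exp_mem_of_isPreconnected {C : Set Circle} (hC : IsPreconnected C) {θ : ℝ}
    (hθ : Circle.exp θ ∉ C) {s t u : ℝ} (hs : θ < s) (hst : s < t) (htu : t < u)
    (hu : u < θ + 2 * π) (hsC : Circle.exp s ∈ C) (huC : Circle.exp u ∈ C) : Circle.exp t ∈ C := by
  by_contra htC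
  have hcov : C ⊆ Circle.exp '' Ioo θ t ∪ Circle.exp '' Ioo t (θ + 2 * π) := by
    intro x hx
    obtain ⟨r, hr1, hr2, rfl⟩ := exists_angle θ x
    have hr1 : θ < r := lt_of_le_of_ne hr1 (by rintro rfl; exact hθ hx)
    rcases lt_trichotomy r t with h | rfl | h
    · exact Or.inl ⟨r, ⟨hr1, h⟩, rfl⟩
    · exact absurd hx htC
    · exact Or.inr ⟨r, ⟨h, hr2⟩, rfl⟩
  obtain ⟨x, hx, ⟨a, ha, hax⟩, b, hb, hbx⟩ := hC _ _ (Lamination.isOpen_exp_image isOpen_Ioo)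
    (Lamination.isOpen_exp_image isOpen_Ioo) hcov
    ⟨_, hsC, s, ⟨hs, hst⟩, rfl⟩ ⟨_, huC, u, ⟨htu, hu⟩, rfl⟩
  exact exp_ne_exp (ha.2.trans hb.1) (by linarith [ha.1, hb.2]) (hax.trans hbx.symm)

/-- A proper connected open subset of the circle is an arc, with at most two boundary points. -/
theorem finite_frontier {C : Set Circle} (ho : IsOpen C) (hC : IsPreconnected C) (hne : C ≠ univ) :
    (frontier C).Finite := by
  rcases C.eq_empty_or_nonempty with rfl | ⟨x₀, hx₀⟩
  · simp
  obtain ⟨z, hz⟩ := (ne_univ_iff_exists_notMem C).1 hne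
  obtain ⟨θ, rfl⟩ := Circle.exp_surjective z
  have hS : ∀ x ∈ C, ∃ t, θ < t ∧ t < θ + 2 * π ∧ Circle.exp t = x := by
    intro x hx
    obtain ⟨t, h1, h2, rfl⟩ := exists_angle θ x
    exact ⟨t, lt_of_le_of_ne h1 (by rintro rfl; exact hz hx), h2, rfl⟩
  set S := {t | θ < t ∧ t < θ + 2 * π ∧ Circle.exp t ∈ C} with hSdef
  have hSne : S.Nonempty := by
    obtain ⟨t, h1, h2, rfl⟩ := hS x₀ hx₀
    exact ⟨t, h1, h2, hx₀⟩
  have hSb : BddBelow S := ⟨θ, fun t ht => ht.1.le⟩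
  have hSa : BddAbove S := ⟨θ + 2 * π, fun t ht => ht.2.1.le⟩
  have hsub : C ⊆ Circle.exp '' Icc (sInf S) (sSup S) := by
    intro x hx
    obtain ⟨t, h1, h2, rfl⟩ := hS x hx
    exact ⟨t, ⟨csInf_le hSb ⟨h1, h2, hx⟩, le_csSup hSa ⟨h1, h2, hx⟩⟩, rfl⟩
  have hcl : closure C ⊆ Circle.exp '' Icc (sInf S) (sSup S) :=
    closure_minimal hsub (isCompact_Icc.image Circle.exp.continuous).isClosed
  refine (({sInf S, sSup S} : Set ℝ).toFinite.image Circle.exp).subset ?_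
  intro x hx
  rw [ho.frontier_eq] at hx
  obtain ⟨t, ⟨h1, h2⟩, rfl⟩ := hcl hx.1
  refine ⟨t, ?_, rfl⟩
  by_contra hnot
  simp only [mem_insert_iff, mem_singleton_iff, not_or] at hnot
  obtain ⟨s, hs, hst⟩ := exists_lt_of_csInf_lt hSne (lt_of_le_of_ne h1 (Ne.symm hnot.1))
  obtain ⟨u, hu, htu⟩ := exists_lt_of_lt_csSup hSne (lt_of_le_of_ne h2 hnot.2)
  exact hx.2 (exp_mem_of_isPreconnected hC hz hs.1 hst htu hu.2.1 hs.2.2 hu.2.2)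

/-- If a minimal set lies in a proper invariant open set `W`, then finitely many components of `W`
meet it, and their boundary points form a finite orbit. -/
theorem exists_finite_orbit {K W : Set Circle} (hK : ClosedInvariant H K) (hW : IsOpen W)
    (hWne : W ≠ univ) (hWH : ∀ g ∈ H, g '' W = W) (hKW : K ⊆ W) :
    ∃ x : Circle, (MulAction.orbit H x).Finite := by
  set 𝒞 : Set (Set Circle) := connectedComponentIn W '' K with h𝒞
  have : LocallyConnectedSpace Circle :=
    ChartedSpace.locallyConnectedSpace (EuclideanSpace ℝ (Fin 1)) Circle
  have hopen : ∀ x, IsOpen (connectedComponentIn W x) := fun x => hW.connectedComponentIn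
  have hfin : 𝒞.Finite := by
    obtain ⟨t, -, ht⟩ := hK.isClosed.isCompact.elim_nhds_subcover (connectedComponentIn W)
      fun x hx => (hopen x).mem_nhds (mem_connectedComponentIn (hKW hx))
    refine (t.finite_toSet.image (connectedComponentIn W)).subset ?_
    rintro _ ⟨x, hx, rfl⟩
    obtain ⟨y, hy, hxy⟩ := mem_iUnion₂.1 (ht hx)
    exact ⟨y, hy, connectedComponentIn_eq hxy⟩
  have hproper : ∀ x, connectedComponentIn W x ≠ univ := fun x h =>
    hWne (eq_univ_of_univ_subset (h ▸ connectedComponentIn_subset W x))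
  have hEfin : (⋃ C ∈ 𝒞, frontier C).Finite := by
    refine hfin.biUnion ?_
    rintro _ ⟨x, -, rfl⟩
    exact finite_frontier (hopen x) isPreconnected_connectedComponentIn (hproper x)
  obtain ⟨x, hx⟩ := hK.nonempty
  obtain ⟨e, he⟩ : (frontier (connectedComponentIn W x)).Nonempty := by
    by_contra h
    rw [not_nonempty_iff_eq_empty, frontier_eq_empty_iff] at h
    rcases h with h | h
    · exact Set.Nonempty.ne_empty ⟨x, mem_connectedComponentIn (hKW hx)⟩ h
    · exact hproper x h
  refine ⟨e, hEfin.subset ?_⟩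
  rintro _ ⟨⟨g, hg⟩, rfl⟩
  refine mem_iUnion₂.2 ⟨connectedComponentIn W (g x), ⟨g x, hK.map_mem g hg x hx, rfl⟩, ?_⟩
  have h1 := g.image_connectedComponentIn (hKW hx)
  rw [hWH g hg] at h1
  rw [← h1, ← g.image_frontier]
  exact mem_image_of_mem g he

/-- Arcs cut off by unlinked leaves are nested or disjoint, or they cover the circle. -/
theorem arcs_unlinked {A : ℝ → ℝ → Prop} (hA : LineLam (2 * π) A) {a b c d : ℝ} (h : A a b)
    (h' : A c d) : Circle.exp '' Ioo a b ⊆ Circle.exp '' Ioo c d ∨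
      Circle.exp '' Ioo c d ⊆ Circle.exp '' Ioo a b ∨
      Disjoint (Circle.exp '' Ioo a b) (Circle.exp '' Ioo c d) ∨
      Circle.exp '' Icc a b ∪ Circle.exp '' Icc c d = univ := by
  by_cases hdis : Disjoint (Circle.exp '' Ioo a b) (Circle.exp '' Ioo c d)
  · exact Or.inr (Or.inr (Or.inl hdis))
  obtain ⟨x, ⟨s, hs, rfl⟩, t, ht, hst⟩ := not_disjoint_iff.1 hdis
  obtain ⟨n, hn⟩ := Circle.exp_eq_exp.1 hst
  have hA' : ∀ n : ℤ, ∀ {c d}, A c d → A (c + n * (2 * π)) (d + n * (2 * π)) := by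
    intro n c d hcd
    induction n using Int.induction_on with
    | zero => simpa using hcd
    | succ n ih =>
      have := hA.swap.2 (hA.swap.2 ih)
      push_cast at this ⊢
      convert this using 1 <;> ring
    | pred n ih =>
      refine hA.swap.1 (hA.swap.1 ?_)
      push_cast at ih ⊢
      convert ih using 1 <;> ring
  have himg : ∀ (n : ℤ) (S : Set ℝ),
      Circle.exp '' ((fun r => r + n * (2 * π)) '' S) = Circle.exp '' S := by
    intro n S
    rw [image_image]
    exact image_congr fun r _ => Circle.exp_eq_exp.2 ⟨n, rfl⟩
  have h2 := hA' (-n) h'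
  rw [← himg (-n) (Ioo c d), ← himg (-n) (Icc c d), image_add_const_Ioo, image_add_const_Icc]
  have hs' : s ∈ Ioo (c + (-n : ℤ) * (2 * π)) (d + (-n : ℤ) * (2 * π)) := by
    push_cast
    constructor <;> linarith [ht.1, ht.2]
  set c' := c + (-n : ℤ) * (2 * π)
  set d' := d + (-n : ℤ) * (2 * π)
  have cover : ∀ p q : Set Circle, 
      ∀ r, Circle.exp '' Icc r (r + 2 * π) ⊆ p ∪ q → p ∪ q = univ := by
    intro p q r hr
    refine eq_univ_of_forall fun x => hr ?_
    obtain ⟨t, h1, h2, rfl⟩ := exists_angle r x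
    exact ⟨t, ⟨h1, h2.le⟩, rfl⟩
  rcases le_total a c' with hac | hca
  · rcases le_or_gt d' b with hdb | hbd
    · exact Or.inr (Or.inl (image_mono (Ioo_subset_Ioo hac hdb)))
    · rcases hac.eq_or_lt with hac | hac
      · exact Or.inl (image_mono (Ioo_subset_Ioo hac.ge hbd.le))
      · refine Or.inr (Or.inr (Or.inr (cover _ _ a ?_)))
        have hd : a + 2 * π ≤ d' := by
          by_contra! hlt
          exact hA.unlinked h h2 hac (hs'.1.trans hs.2) hbd hlt
        rw [← image_union]
        refine image_mono fun r hr => ?_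
        rcases le_total r b with hrb | hrb
        · exact Or.inl ⟨hr.1, hrb⟩
        · exact Or.inr ⟨by linarith [hs'.1, hs.2], by linarith [hr.2]⟩
  · rcases le_or_gt b d' with hbd | hdb
    · exact Or.inl (image_mono (Ioo_subset_Ioo hca hbd))
    · rcases hca.eq_or_lt with hca | hca
      · exact Or.inr (Or.inl (image_mono (Ioo_subset_Ioo hca.ge hdb.le)))
      · refine Or.inr (Or.inr (Or.inr (cover _ _ c' ?_)))
        have hd : c' + 2 * π ≤ b := by
          by_contra! hlt
          exact hA.unlinked h2 h hca (hs.1.trans hs'.2) hdb hlt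
        rw [← image_union]
        refine image_mono fun r hr => ?_
        rcases le_total r d' with hrb | hrb
        · exact Or.inr ⟨hr.1, hrb⟩
        · exact Or.inl ⟨by linarith [hs.1, hs'.2], by linarith [hr.2]⟩

theorem IsLift.image_exp {F : ℝ ≃o ℝ} {g : Circle ≃ₜ Circle} (hF : IsLift F g) (S : Set ℝ) :
    g '' (Circle.exp '' S) = Circle.exp '' (F '' S) := by
  rw [image_image, image_image]
  exact image_congr fun t _ => hF.map_exp t

/-- Let `a < θ < b` be the angles of a leaf, with `θ` in a minimal set. If there is no finite orbit,
then some group element moves the complement of the arc from `a` to `b` into that arc: otherwise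
the translates of the open arc are pairwise nested or disjoint, so they do not cover the circle. -/
theorem exists_flip {A : ℝ → ℝ → Prop} (hA : LineLam (2 * π) A)
    (hlift : ∀ g ∈ H, ∃ F, IsLift F g ∧ Preserves (2 * π) A F)
    (horb : ∀ x : Circle, (MulAction.orbit H x).Infinite) {K : Set Circle}
    (hK : Minimal (ClosedInvariant H) K) {θ a b : ℝ} (hθ : Circle.exp θ ∈ K) (hab : A a b)
    (haθ : a < θ) (hθb : θ < b) :
    ∃ f ∈ H, ∀ x, x ∈ Circle.exp '' Icc a b ∨ f x ∈ Circle.exp '' Icc a b := by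
  set I := Circle.exp '' Ioo a b with hI
  set J := Circle.exp '' Icc a b with hJ
  set W : Set Circle := ⋃ h : H, h.1 '' I with hW
  have hIo : IsOpen I := Lamination.isOpen_exp_image isOpen_Ioo
  have hho : ∀ h : H, IsOpen (h.1 '' I) := fun h => h.1.isOpenMap _ hIo
  have hWo : IsOpen W := isOpen_iUnion hho
  have hWH : ∀ g ∈ H, g '' W ⊆ W := by
    intro g hg
    rw [hW, image_iUnion]
    refine iUnion_subset fun h => ?_
    refine subset_trans ?_ (subset_iUnion (fun h : H => h.1 '' I) (⟨g, hg⟩ * h))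
    rw [image_image]
    exact Subset.rfl
  have hWH' : ∀ g ∈ H, g '' W = W := by
    intro g hg
    refine (hWH g hg).antisymm fun x hx => ⟨g⁻¹ x, hWH _ (H.inv_mem hg) (mem_image_of_mem _ hx), ?_⟩
    rw [← Homeomorph.mul_apply, mul_inv_cancel, Homeomorph.one_apply]
  have hKW : K ⊆ W := by
    by_contra hnot
    obtain ⟨x, hx, hxW⟩ := not_subset.1 hnot
    have hci : ClosedInvariant H (K ∩ Wᶜ) :=
      ⟨hK.prop.isClosed.inter hWo.isClosed_compl, ⟨x, hx, hxW⟩, fun g hg y hy =>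
        ⟨hK.prop.map_mem g hg y hy.1, fun hgy => hy.2 (by
          rw [← hWH' g hg] at hgy
          exact (g.injective.mem_set_image).1 hgy)⟩⟩
    have hsub : K ⊆ K ∩ Wᶜ := hK.le_of_le hci inter_subset_left
    refine (hsub hθ).2 (mem_iUnion.2 ⟨1, ?_⟩)
    exact ⟨_, ⟨θ, ⟨haθ, hθb⟩, rfl⟩, rfl⟩
  have hWuniv : W = univ := by
    by_contra hne
    obtain ⟨x, hx⟩ := exists_finite_orbit hK.prop hWo hne hWH' hKW
    exact horb x hx
  by_contra! hcon
  have hnested : ∀ h k : H, h.1 '' I ⊆ k.1 '' I ∨ k.1 '' I ⊆ h.1 '' I ∨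
      Disjoint (h.1 '' I) (k.1 '' I) := by
    intro h k
    obtain ⟨F, hF, hFA⟩ := hlift h.1 h.2
    obtain ⟨F', hF', hFA'⟩ := hlift k.1 k.2
    have := arcs_unlinked hA (hFA.map.2 hab) (hFA'.map.2 hab)
    rw [← F.image_Ioo, ← F'.image_Ioo, ← F.image_Icc, ← F'.image_Icc, ← hF.image_exp,
      ← hF'.image_exp, ← hF.image_exp, ← hF'.image_exp] at this
    rcases this with h1 | h1 | h1 | h1
    · exact Or.inl h1
    · exact Or.inr (Or.inl h1)
    · exact Or.inr (Or.inr h1)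
    · obtain ⟨x, hx1, hx2⟩ := hcon (h.1⁻¹ * k.1) (H.mul_mem (H.inv_mem h.2) k.2)
      rcases h1.ge (mem_univ (k.1 x)) with ⟨y, hy, hxy⟩ | ⟨y, hy, hxy⟩
      · refine absurd ?_ hx2
        rw [Homeomorph.mul_apply, ← hxy, ← Homeomorph.mul_apply, inv_mul_cancel]
        exact hy
      · exact absurd (k.1.injective hxy ▸ hy) hx1
  obtain ⟨t, ht⟩ := isCompact_univ.elim_finite_subcover (fun h : H => h.1 '' I) hho hWuniv.ge
  have htne : t.Nonempty := by
    by_contra h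
    rw [Finset.not_nonempty_iff_eq_empty] at h
    obtain ⟨k, hk, -⟩ := mem_iUnion₂.1 (ht (mem_univ (1 : Circle)))
    rw [h] at hk
    simp at hk
  obtain ⟨m, hm⟩ := t.finite_toSet.exists_maximalFor (fun h : H => h.1 '' I) _ htne
  -- the complement of a maximal arc is the union of the arcs disjoint from it
  have hclosed : IsClosed (m.1 '' I) := by
    have : (m.1 '' I)ᶜ = ⋃ h ∈ {h : H | Disjoint (h.1 '' I) (m.1 '' I)}, h.1 '' I := by
      ext x
      simp only [mem_compl_iff, mem_iUnion, mem_ofPred_eq, exists_prop]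
      constructor
      · intro hx
        obtain ⟨k, hk, hxk⟩ := mem_iUnion₂.1 (ht (mem_univ x))
        refine ⟨k, ?_, hxk⟩
        rcases hnested k m with h1 | h1 | h1
        · exact absurd (h1 hxk) hx
        · exact absurd (hm.2 hk h1 hxk) hx
        · exact h1
      · rintro ⟨k, hk, hxk⟩ hx
        exact disjoint_left.1 hk hxk hx
    rw [← isOpen_compl_iff, this]
    exact isOpen_biUnion fun h _ => hho h
  rcases isClopen_iff.1 ⟨hclosed, hho m⟩ with h0 | h0
  · exact (Nonempty.image m.1 ⟨_, θ, ⟨haθ, hθb⟩, rfl⟩ : (m.1 '' I).Nonempty).ne_empty h0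
  · obtain ⟨x, ⟨s, hs, rfl⟩, hx⟩ := h0.ge (mem_univ (m.1 (Circle.exp a)))
    have := hA.lt_add hab
    exact exp_ne_exp hs.1 (by linarith [hs.2]) (m.1.injective hx).symm

theorem freeGroup_of_ne : (FreeGroup.of true : FreeGroup Bool) * FreeGroup.of false ≠
    FreeGroup.of false * FreeGroup.of true := by
  decide

theorem containsNonabelianFree_of_injective {Γ : Type*} [Group Γ] {φ : FreeGroup Bool →* Γ}
    (hφ : Function.Injective φ) : ContainsNonabelianFree Γ := by
  refine ⟨φ.range, IsFreeGroup.ofMulEquiv (MonoidHom.ofInjective hφ), φ (FreeGroup.of true),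
    ⟨_, rfl⟩, φ (FreeGroup.of false), ⟨_, rfl⟩, ?_⟩
  rw [← map_mul, ← map_mul]
  exact fun h => freeGroup_of_ne (hφ h)

/-- A group of automorphisms of a lamination without finite orbits contains a free group: the flip
of a small arc around a point of the minimal set, conjugated by group elements that move the arc to
disjoint places, gives elements that play ping-pong. -/
theorem containsFree_of_infinite_orbits {A : ℝ → ℝ → Prop} (hA : LineLam (2 * π) A)
    (hlift : ∀ g ∈ H, ∃ F, IsLift F g ∧ Preserves (2 * π) A F)
    (horb : ∀ x : Circle, (MulAction.orbit H x).Infinite) {K : Set Circle}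
    (hK : Minimal (ClosedInvariant H) K) {θ : ℝ} (hθ : Circle.exp θ ∈ K)
    (hend : ∀ b, ¬ A θ b) : ContainsNonabelianFree H := by
  have hinf := horb (Circle.exp θ)
  set e := hinf.natEmbedding
  choose k hk using fun n => (e n).2
  have hk' : ∀ n, (k n).1 (Circle.exp θ) = (e n).1 := hk
  have hfin : (range fun i : Bool × Bool => (e (2 * i.1.toNat + i.2.toNat)).1).Finite :=
    finite_range _
  obtain ⟨U, hU, hdisj⟩ := hfin.t2_separation
  let κ : Bool × Bool → H := fun i => k (2 * i.1.toNat + i.2.toNat)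
  have hκinj : ∀ i j : Bool × Bool, i ≠ j →
      (κ i).1 (Circle.exp θ) ≠ (κ j).1 (Circle.exp θ) := by
    intro i j hij h
    change (k _).1 _ = (k _).1 _ at h
    rw [hk', hk'] at h
    have := e.injective (Subtype.ext h)
    obtain ⟨i1, i2⟩ := i
    obtain ⟨j1, j2⟩ := j
    cases i1 <;> cases i2 <;> cases j1 <;> cases j2 <;> simp_all
  have hopen : IsOpen (Circle.exp ⁻¹' ⋂ i, (κ i).1 ⁻¹' U ((κ i).1 (Circle.exp θ))) :=
    (isOpen_iInter_of_finite fun i => (hU _).2.preimage (κ i).1.continuous).preimage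
      Circle.exp.continuous
  obtain ⟨ε, hε, hball⟩ := Metric.isOpen_iff.1 hopen θ (mem_iInter.2 fun i => (hU _).1)
  obtain ⟨a, b, hab, h1, h2, h3, h4⟩ := hA.rainbow hend ε hε
  obtain ⟨f, hf, hflip⟩ := exists_flip hA hlift horb hK hθ hab h2 h3
  set J := Circle.exp '' Icc a b with hJ
  have hJU : ∀ i, (κ i).1 '' J ⊆ U ((κ i).1 (Circle.exp θ)) := by
    rintro i _ ⟨_, ⟨t, ht, rfl⟩, rfl⟩
    refine mem_iInter.1 (hball (a := t) ?_) i
    rw [Metric.mem_ball, Real.dist_eq, abs_lt]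
    constructor <;> linarith [ht.1, ht.2]
  have hJdisj : ∀ i j, i ≠ j → Disjoint ((κ i).1 '' J) ((κ j).1 '' J) := fun i j hij =>
    (hdisj ⟨i, (hk' _).symm⟩ ⟨j, (hk' _).symm⟩ (hκinj i j hij)).mono (hJU i) (hJU j)
  let α : Bool → H := fun i => κ (i, true) * ⟨f, hf⟩ * (κ (i, false))⁻¹
  have hα : ∀ i x, x ∉ (κ (i, false)).1 '' J → (α i).1 x ∈ (κ (i, true)).1 '' J := by
    intro i x hx
    have hx' : (κ (i, false)).1⁻¹ x ∉ J := fun h => hx ⟨_, h, by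
      rw [← Homeomorph.mul_apply, mul_inv_cancel, Homeomorph.one_apply]⟩
    exact mem_image_of_mem _ ((hflip _).resolve_left hx')
  have hinj := FreeGroup.injective_lift_of_ping_pong α
    (fun i => (κ (i, true)).1 '' J) (fun i => (κ (i, false)).1 '' J)
    (fun i => Nonempty.image _ ⟨_, θ, ⟨h2.le, h3.le⟩, rfl⟩)
    (fun i j hij => hJdisj _ _ (by simpa using hij))
    (fun i j hij => hJdisj _ _ (by simpa using hij))
    (fun i j => hJdisj _ _ (by simp)) ?_ ?_
  · exact containsNonabelianFree_of_injective hinj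
  · rintro i _ ⟨x, hx, rfl⟩
    exact hα i x hx
  · rintro i _ ⟨x, hx, rfl⟩
    by_contra hnot
    have := hα i _ hnot
    refine hx ?_
    have hcancel : (α i).1 ((α⁻¹ i).1 x) = x := by
      rw [← Homeomorph.mul_apply, ← Subgroup.coe_mul, Pi.inv_apply, mul_inv_cancel]
      rfl
    rwa [← hcancel]

end CircleLam

open CircleLam in
theorem theoremA (G : Subgroup (Circle ≃ₜ Circle)) (hG : CircleLam.IsPseudoFibered G)
    (htf : ∀ g ∈ G, g ≠ 1 → ¬ IsOfFinOrder g)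
    (H : Subgroup (Circle ≃ₜ Circle)) (hH : H ≤ G) :
    ContainsNonabelianFree H ∨ IsVirtuallyAbelian H := by
  by_cases horb : ∀ x : Circle, (MulAction.orbit H x).Infinite
  · left
    obtain ⟨-, ⟨hor, -, -⟩, ⟨L₁, L₂, ⟨hf1, hl1, hi1⟩, ⟨hf2, hl2, hi2⟩, hd⟩, -⟩ := hG
    have hT := transverse_lift ⟨hf1, hl1⟩ ⟨hf2, hl2⟩ hd
    have hlift : ∀ L : Lamination, L.IsInvariant G → ∀ g ∈ H, ∃ F, IsLift F g ∧
        Preserves (2 * Real.pi) L.lift F := by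
      intro L hL g hg
      obtain ⟨F, hF⟩ := (hor g (hH hg)).exists_lift
      exact ⟨F, hF, hF.preserves hL (hH hg)⟩
    obtain ⟨K, hK⟩ := exists_minimal_closedInvariant H
    obtain ⟨x, hx⟩ := hK.prop.nonempty
    obtain ⟨θ, rfl⟩ := Circle.exp_surjective x
    by_cases hend : ∀ b, ¬ L₁.lift θ b
    · exact containsFree_of_infinite_orbits hT.fst (hlift L₁ hi1) horb hK hx hend
    · push Not at hend
      obtain ⟨b, hb⟩ := hend
      exact containsFree_of_infinite_orbits hT.snd (hlift L₂ hi2) horb hK hx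
        fun c hc => hT.disjoint hb hc
  · right
    push Not at horb
    obtain ⟨x, hx⟩ := horb
    refine ⟨MulAction.stabilizer H x, ⟨?_⟩, fun g hg h hh => ?_⟩
    · rw [MulAction.index_stabilizer]
      exact ((Set.ncard_pos hx).2 (MulAction.nonempty_orbit x)).ne'
    · exact Subtype.ext (hG.commute_of_fixed (hH g.2) (hH h.2) hg hh)
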